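/- Let $\mathbb K$ be a field of characteristic zero and let $\Gamma=(V,E,s,t)$ be a multiquiver: $V$ and $E$ are arbitrary sets and $s,t:E\to (V\times\mathbb Z_{>0})\cup\{\emptyset\}$ are maps such that $s(e)=(u,m)$, $t(e)=(v,n)$ imply $u\ne v$, and such that each $v\in V$ is the source or target of only finitely many edges. Put $\gamma_{ev}=n$ if $t(e)=(v,n)$, $\gamma_{ev}=-n$ if $s(e)=(v,n)$, and $\gamma_{ev}=0$ otherwise (when $v$ is not incident to $e$). Let $R=\mathbb K[u_e\mid e\in E]$, let $\sigma_v$ $(v\in V)$ be the automorphism of $R$ with $\sigma_v(u_e)=u_e-\gamma_{ev}$, and let $t_v=\prod_{e} u_{ev}$, the product over the edges incident to $v$, where $u_{ev}=u_e(u_e+1)\cdots(u_e+n-1)$ if $t(e)=(v,n)$ and $u_{ev}=(u_e-1)(u_e-2)\cdots(u_e-n)$ if $s(e)=(v,n)$. Let $\mathcal C$ be the ring generated by $R$ and symbols $X_v,Y_v$ $(v\in V)$ with relations $X_v r=\sigma_v(r)X_v$, $Y_v r=\sigma_v^{-1}(r)Y_v$ $(r\in R)$, $Y_vX_v=t_v$,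 $X_vY_v=\sigma_v(t_v)$, and $X_vY_w=Y_wX_v$ for $v\ne w$. It is $\mathbb ZV$-graded by $\deg r=0$, $\deg X_v=v$, $\deg Y_v=-v$. Let $\mathcal A(\Gamma)$ be the quotient of $\mathcal C$ by the sum of all graded two-sided ideals that meet the degree zero component $\mathcal C_0$ only in $0$, with the induced $\mathbb ZV$-grading (this is the twisted generalized Weyl algebra of $\Gamma$). Let $C=(a_{ij})_{i,j\in V}$ be the generalized Cartan matrix of the Dynkin diagram $D(\Gamma)$: $a_{ii}=2$ and, for $i\ne j$, $a_{ij}=-\sum_e|\gamma_{ej}|$, the sum over the edges $e$ between $i$ and $j$. Let $\mathfrak h$ be a $\mathbb K$-vector space with linearly independent simple coroots $\alpha_i^\vee\in\mathfrak h$ and linearly independent simple roots $\alpha_i\in\mathfrak h^*$ $(i\in V)$ such that $\alpha_j(\alpha_i^\vee)=a_{ij}$. Let $\mathfrak g$ be the associated Kac–Moody algebra, i.e. the Lie algebra generated by the vector space $\mathfrak h$ and elements $e_i,f_i$ $(i\in V)$ subject to $$[h,h']=0,\quad [e_i,f_j]=\delta_{ij}\alpha_i^\vee,\quad [h,e_i]=\alpha_i(h)e_i,\quad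 [h,f_i]=-\alpha_i(h)f_i\qquad(h,h'\in\mathfrak h),$$ $$(\operatorname{ad}e_i)^{1-a_{ij}}e_j=0=(\operatorname{ad}f_i)^{1-a_{ij}}f_j\qquad(i\neq j).$$ Let $\mathfrak n^+$ and $\mathfrak n^-$ be the subalgebras of $\mathfrak g$ generated by the $e_i$ and by the $f_i$, respectively. For $\beta=\sum_i d_i\alpha_i$ with $d=(d_i)\in\mathbb ZV$, let $U(\mathfrak n^\pm)_\beta$ be the space of weight $\beta$ for the adjoint action of $\mathfrak h$ on $U(\mathfrak n^\pm)$. **Theorem 5.4.** There exist homomorphisms of unital $\mathbb K$-algebras $$\psi^+:U(\mathfrak n^+)\to\mathcal A(\Gamma),\ e_i\mapsto X_i,\qquad \psi^-:U(\mathfrak n^-)\to\mathcal A(\Gamma),\ f_i\mapsto Y_i\qquad(i\in V),$$ which are graded: $\psi^\pm\big(U(\mathfrak n^\pm)_{\sum_i d_i\alpha_i}\big)\subseteq\mathcal A(\Gamma)_d$ for all $d\in\mathbb ZV$. Moreover, for all $i,j\in V$ with $i\ne j$ and all integers $k$ with $0\le k\le -a_{ij}$, the restrictions $$\psi^+|_{U(\mathfrak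 n^+)_{k\alpha_i+\alpha_j}}\qquad\text{and}\qquad\psi^-|_{U(\mathfrak n^-)_{-k\alpha_i-\alpha_j}}$$ are injective. -/

import Mathlib

/-! ### Twisted generalized Weyl algebras -/

/-- A twisted generalized Weyl datum `(R, σ, t)` over `K` with index set `I`: commuting
`K`-algebra automorphisms `σ i` of `R` and nonzero central elements `t i` of `R`. -/
structure TGWDatum (K R I : Type*) [Field K] [Ring R] [Algebra K R] where
  σ : I → (R ≃ₐ[K] R)
  t : I → R
  σ_comm : ∀ i j r, σ i (σ j r) = σ j (σ i r)
  t_ne_zero : ∀ i, t i ≠ 0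
  t_central : ∀ i r, t i * r = r * t i

namespace TGWDatum

/-- Generators of the twisted generalized Weyl construction: the elements of the base ring `R` and
the symbols `X i`, `Y i`. -/
inductive Gen (R I : Type*)
  | coeff (r : R) : Gen R I
  | X (i : I) : Gen R I
  | Y (i : I) : Gen R I

/-- The degree of a generator in the free abelian group on `I`. -/
noncomputable def Gen.deg {R I : Type*} : Gen R I → (I →₀ ℤ)
  | .coeff _ => 0
  | .X i => Finsupp.single i 1
  | .Y i => Finsupp.single i (-1)

variable {K R I : Type*} [Field K] [Ring R] [Algebra K R]

/-- Abbreviation for the generators inside the free algebra. -/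
def Gen.free (K : Type*) {R I : Type*} [Field K] (g : Gen R I) : FreeAlgebra K (Gen R I) :=
  FreeAlgebra.ι K g

/-- Defining relations of the twisted generalized Weyl construction. The first three say that
`R` maps to the quotient by a `K`-algebra homomorphism (so that the quotient by them is the free
`R`-ring on the `X i`, `Y i`, with scalars of `K` made central, which the commutation
relations force anyway); the others are the relations of the construction. -/
inductive Rel (D : TGWDatum K R I) (μ : I → I → Kˣ) :
    FreeAlgebra K (Gen R I) → FreeAlgebra K (Gen R I) → Prop
  | coeff_add (r s : R) : Rel D μ (Gen.free K (.coeff (r + s)))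
      (Gen.free K (.coeff r) + Gen.free K (.coeff s))
  | coeff_mul (r s : R) : Rel D μ (Gen.free K (.coeff (r * s)))
      (Gen.free K (.coeff r) * Gen.free K (.coeff s))
  | coeff_scalar (c : K) : Rel D μ (Gen.free K (.coeff (algebraMap K R c)))
      (algebraMap K (FreeAlgebra K (Gen R I)) c)
  | X_coeff (i : I) (r : R) : Rel D μ (Gen.free K (.X i) * Gen.free K (.coeff r))
      (Gen.free K (.coeff (D.σ i r)) * Gen.free K (.X i))
  | Y_coeff (i : I) (r : R) : Rel D μ (Gen.free K (.Y i) * Gen.free K (.coeff r))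
      (Gen.free K (.coeff ((D.σ i).symm r)) * Gen.free K (.Y i))
  | Y_X (i : I) : Rel D μ (Gen.free K (.Y i) * Gen.free K (.X i)) (Gen.free K (.coeff (D.t i)))
  | X_Y (i : I) : Rel D μ (Gen.free K (.X i) * Gen.free K (.Y i))
      (Gen.free K (.coeff (D.σ i (D.t i))))
  | X_Y_ne (i j : I) (h : i ≠ j) : Rel D μ (Gen.free K (.X i) * Gen.free K (.Y j))
      ((μ i j : K) • (Gen.free K (.Y j) * Gen.free K (.X i)))

/-- The twisted generalized Weyl construction. -/
abbrev Construction (D : TGWDatum K R I) (μ : I → I → Kˣ) := RingQuot (D.Rel μ)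

/-- The image of a generator in the twisted generalized Weyl construction. -/
noncomputable def cgen (D : TGWDatum K R I) (μ : I → I → Kˣ) (g : Gen R I) : D.Construction μ :=
  RingQuot.mkAlgHom K (D.Rel μ) (Gen.free K g)

/-- The homogeneous component of degree `d` of the twisted generalized Weyl construction: the span
of all products of generators of total degree `d`. -/
def cdeg (D : TGWDatum K R I) (μ : I → I → Kˣ) (d : I →₀ ℤ) : Submodule K (D.Construction μ) :=
  Submodule.span K
    {x | ∃ l : List (Gen R I), (l.map Gen.deg).sum = d ∧ x = (l.map (D.cgen μ)).prod}

/-- A two-sided ideal is graded if each of its elements is a sum of homogeneous elements of the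
ideal. -/
def IsGraded (D : TGWDatum K R I) (μ : I → I → Kˣ) (J : TwoSidedIdeal (D.Construction μ)) : Prop :=
  ∀ x ∈ J, x ∈ AddSubgroup.closure {y | y ∈ J ∧ ∃ d, y ∈ D.cdeg μ d}

/-- The sum of all graded ideals having zero intersection with the degree zero component. -/
def radical (D : TGWDatum K R I) (μ : I → I → Kˣ) : TwoSidedIdeal (D.Construction μ) :=
  sSup {J | D.IsGraded μ J ∧ ∀ x ∈ J, x ∈ D.cdeg μ 0 → x = 0}

/-- The twisted generalized Weyl algebra. -/
abbrev TGWAlgebra (D : TGWDatum K R I) (μ : I → I → Kˣ) := (D.radical μ).ringCon.Quotient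

/-- The canonical projection from the construction to the algebra. -/
noncomputable def proj (D : TGWDatum K R I) (μ : I → I → Kˣ) :
    D.Construction μ →ₐ[K] D.TGWAlgebra μ :=
  RingCon.mkₐ K (D.radical μ).ringCon

/-- The element `X i` of the twisted generalized Weyl algebra. -/
noncomputable def X (D : TGWDatum K R I) (μ : I → I → Kˣ) (i : I) : D.TGWAlgebra μ :=
  D.proj μ (D.cgen μ (.X i))

/-- The element `Y i` of the twisted generalized Weyl algebra. -/
noncomputable def Y (D : TGWDatum K R I) (μ : I → I → Kˣ) (i : I) : D.TGWAlgebra μ :=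
  D.proj μ (D.cgen μ (.Y i))

/-- The homogeneous component of degree `d` of the twisted generalized Weyl algebra. -/
noncomputable def deg (D : TGWDatum K R I) (μ : I → I → Kˣ) (d : I →₀ ℤ) :
    Submodule K (D.TGWAlgebra μ) :=
  (D.cdeg μ d).map (D.proj μ).toLinearMap

end TGWDatum

/-! ### Multiquivers and their algebras -/

/-- A multiquiver with vertex set `V` and edge set `E`. The value `none` of `s` or `t` means that
the edge has no source, respectively no target. -/
structure Multiquiver (V E : Type*) where
  s : E → Option (V × ℕ+)
  t : E → Option (V × ℕ+)
  no_loops : ∀ e u v m n, s e = some (u, m) → t e = some (v, n) → u ≠ v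
  finite_s : ∀ v, {e | ∃ n, s e = some (v, n)}.Finite
  finite_t : ∀ v, {e | ∃ n, t e = some (v, n)}.Finite

namespace Multiquiver

open Classical in
/-- The multiplicity of an end of an edge at the vertex `v` (zero if that end is not at `v`). -/
noncomputable def endMult {V : Type*} (v : V) : Option (V × ℕ+) → ℕ
  | none => 0
  | some (w, n) => if w = v then (n : ℕ) else 0

variable {V E : Type*} (Γ : Multiquiver V E)

/-- The entry `γ_{ev}` of the incidence matrix. -/
noncomputable def incidence (e : E) (v : V) : ℤ :=
  (endMult v (Γ.t e) : ℤ) - (endMult v (Γ.s e) : ℤ)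

/-- The vertex `v` is incident to the edge `e`. -/
def Incident (e : E) (v : V) : Prop :=
  (∃ n, Γ.s e = some (v, n)) ∨ (∃ n, Γ.t e = some (v, n))

lemma finite_incident (v : V) : {e | Γ.Incident e v}.Finite :=
  (Γ.finite_s v).union (Γ.finite_t v)

/-- The finite set of edges incident to `v`. -/
noncomputable def edgesAt (v : V) : Finset E := (Γ.finite_incident v).toFinset

open Classical in
/-- The generalized Cartan matrix of the Dynkin diagram of the multiquiver: leaves and orientations
are forgotten, and the edges between two distinct vertices `i`, `j` (the edges incident to both)
are merged by adding their multiplicities, so that `- a i j` is the sum of the multiplicities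
at `j`. -/
noncomputable def cartan (i j : V) : ℤ :=
  if i = j then 2 else - ∑ e ∈ Γ.edgesAt i ∩ Γ.edgesAt j, |Γ.incidence e j|

variable (K : Type*) [Field K]

/-- The automorphism `u_e ↦ u_e - γ_{ev}` of the polynomial algebra. -/
noncomputable def sigma (v : V) : MvPolynomial E K ≃ₐ[K] MvPolynomial E K :=
  AlgEquiv.ofAlgHom
    (MvPolynomial.aeval fun e => MvPolynomial.X e - MvPolynomial.C (Γ.incidence e v : K))
    (MvPolynomial.aeval fun e => MvPolynomial.X e + MvPolynomial.C (Γ.incidence e v : K))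
    (by ext e; simp) (by ext e; simp)

/-- The factor `u_{ev}`: it is `u_e (u_e + 1) ⋯ (u_e + n - 1)` if `e` has target `v` with
multiplicity `n`, and `(u_e - 1) ⋯ (u_e - n)` if `e` has source `v` with multiplicity `n`
(since there are no loops, at most one of the two products below is nonempty). -/
noncomputable def uFactor (e : E) (v : V) : MvPolynomial E K :=
  (∏ k ∈ Finset.range (endMult v (Γ.t e)), (MvPolynomial.X e + MvPolynomial.C (k : K))) *
    ∏ k ∈ Finset.range (endMult v (Γ.s e)), (MvPolynomial.X e - MvPolynomial.C ((k : K) + 1))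

/-- The element `t_v`. -/
noncomputable def tElem (v : V) : MvPolynomial E K := ∏ e ∈ Γ.edgesAt v, Γ.uFactor K e v

lemma tElem_ne_zero (v : V) : Γ.tElem K v ≠ 0 := by
  have key : ∀ (e : E) (c : K), (MvPolynomial.X e + MvPolynomial.C c : MvPolynomial E K) ≠ 0 := by
    intro e c h
    have h2 := congrArg (MvPolynomial.eval fun _ => 1 - c) h
    simp at h2
  refine Finset.prod_ne_zero_iff.2 fun e _ => mul_ne_zero ?_ ?_
  · exact Finset.prod_ne_zero_iff.2 fun k _ => key e k
  · refine Finset.prod_ne_zero_iff.2 fun k _ => ?_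
    rw [sub_eq_add_neg, ← map_neg]
    exact key e _

/-- The twisted generalized Weyl datum attached to a multiquiver. -/
noncomputable def datum : TGWDatum K (MvPolynomial E K) V where
  σ := Γ.sigma K
  t := Γ.tElem K
  σ_comm i j r := by
    have h : ((Γ.sigma K i : MvPolynomial E K →ₐ[K] MvPolynomial E K).comp
        (Γ.sigma K j : MvPolynomial E K →ₐ[K] MvPolynomial E K)) =
        ((Γ.sigma K j : MvPolynomial E K →ₐ[K] MvPolynomial E K).comp
        (Γ.sigma K i : MvPolynomial E K →ₐ[K] MvPolynomial E K)) := by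
      ext e
      simp [sigma]
      ring
    exact DFunLike.congr_fun h r
  t_ne_zero := Γ.tElem_ne_zero K
  t_central i r := mul_comm _ _

/-- The algebra of a multiquiver: the twisted generalized Weyl algebra of its datum, with all
`μ i j = 1`. -/
abbrev Alg := (Γ.datum K).TGWAlgebra (fun _ _ => 1)

/-- The generator `X_v` of the algebra of a multiquiver. -/
noncomputable def X (v : V) : Γ.Alg K := (Γ.datum K).X (fun _ _ => 1) v

/-- The generator `Y_v` of the algebra of a multiquiver. -/
noncomputable def Y (v : V) : Γ.Alg K := (Γ.datum K).Y (fun _ _ => 1) v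

/-- The homogeneous components of the algebra of a multiquiver. -/
noncomputable def algDeg (d : V →₀ ℤ) : Submodule K (Γ.Alg K) :=
  (Γ.datum K).deg (fun _ _ => 1) d

end Multiquiver

section Adjoint

attribute [local instance] LieRing.ofAssociativeRing

variable {K L : Type*} [Field K] [LieRing L] [LieAlgebra K L]

/-- For a derivation `δ` of a Lie algebra, the algebra homomorphism `a ↦ a + ε (δ a)` from the
enveloping algebra to its dual numbers. -/
noncomputable def envelopingDerivAux (δ : LieDerivation K L L) :
    UniversalEnvelopingAlgebra K L →ₐ[K]
      TrivSqZeroExt (UniversalEnvelopingAlgebra K L) (UniversalEnvelopingAlgebra K L) :=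
  UniversalEnvelopingAlgebra.lift K
    { toFun := fun x => TrivSqZeroExt.inl (UniversalEnvelopingAlgebra.ι K x) +
        TrivSqZeroExt.inr (UniversalEnvelopingAlgebra.ι K (δ x))
      map_add' := by intro x y; ext <;> simp
      map_smul' := by intro c x; ext <;> simp
      map_lie' := by
        intro x y
        ext
        · simp only [TrivSqZeroExt.fst_add, TrivSqZeroExt.fst_inl, TrivSqZeroExt.fst_inr,
            add_zero, LieRing.of_associative_ring_bracket, TrivSqZeroExt.fst_sub,
            TrivSqZeroExt.fst_mul, LieHom.map_lie]
        · simp only [TrivSqZeroExt.snd_add, TrivSqZeroExt.snd_inl, TrivSqZeroExt.snd_inr,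
            TrivSqZeroExt.fst_add, TrivSqZeroExt.fst_inl, TrivSqZeroExt.fst_inr,
            zero_add, add_zero, LieRing.of_associative_ring_bracket, TrivSqZeroExt.snd_sub,
            TrivSqZeroExt.snd_mul, LieHom.map_lie, LieDerivation.apply_lie_eq_sub, map_sub,
            smul_eq_mul, MulOpposite.smul_eq_mul_unop, MulOpposite.unop_op]
          abel }

/-- The derivation of the enveloping algebra that extends the derivation `δ` of the Lie algebra. -/
noncomputable def envelopingDeriv (δ : LieDerivation K L L) :
    UniversalEnvelopingAlgebra K L →ₗ[K] UniversalEnvelopingAlgebra K L where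
  toFun a := (envelopingDerivAux δ a).snd
  map_add' a b := by rw [map_add, TrivSqZeroExt.snd_add]
  map_smul' c a := by rw [map_smul, TrivSqZeroExt.snd_smul, RingHom.id_apply]

lemma envelopingDerivAux_ι (δ : LieDerivation K L L) (x : L) :
    envelopingDerivAux δ (UniversalEnvelopingAlgebra.ι K x) =
      TrivSqZeroExt.inl (UniversalEnvelopingAlgebra.ι K x) +
        TrivSqZeroExt.inr (UniversalEnvelopingAlgebra.ι K (δ x)) := by
  rw [envelopingDerivAux, UniversalEnvelopingAlgebra.lift_ι_apply]
  rfl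

lemma envelopingDeriv_ι (δ : LieDerivation K L L) (x : L) :
    envelopingDeriv δ (UniversalEnvelopingAlgebra.ι K x) =
      UniversalEnvelopingAlgebra.ι K (δ x) := by
  change (envelopingDerivAux δ (UniversalEnvelopingAlgebra.ι K x)).snd = _
  rw [envelopingDerivAux_ι, TrivSqZeroExt.snd_add, TrivSqZeroExt.snd_inl, TrivSqZeroExt.snd_inr,
    zero_add]

lemma envelopingDerivAux_fst (δ : LieDerivation K L L) (a : UniversalEnvelopingAlgebra K L) :
    (envelopingDerivAux δ a).fst = a := by
  have h : (TrivSqZeroExt.fstHom K (UniversalEnvelopingAlgebra K L)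
      (UniversalEnvelopingAlgebra K L)).comp (envelopingDerivAux δ) = AlgHom.id K _ := by
    apply UniversalEnvelopingAlgebra.hom_ext
    ext x
    change (envelopingDerivAux δ (UniversalEnvelopingAlgebra.ι K x)).fst = _
    rw [envelopingDerivAux_ι, TrivSqZeroExt.fst_add, TrivSqZeroExt.fst_inl,
      TrivSqZeroExt.fst_inr, add_zero]
    rfl
  exact DFunLike.congr_fun h a

lemma envelopingDeriv_mul (δ : LieDerivation K L L) (a b : UniversalEnvelopingAlgebra K L) :
    envelopingDeriv δ (a * b) = a * envelopingDeriv δ b + envelopingDeriv δ a * b := by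
  change (envelopingDerivAux δ (a * b)).snd =
    a * (envelopingDerivAux δ b).snd + (envelopingDerivAux δ a).snd * b
  rw [map_mul, TrivSqZeroExt.snd_mul, envelopingDerivAux_fst, envelopingDerivAux_fst,
    smul_eq_mul, MulOpposite.smul_eq_mul_unop, MulOpposite.unop_op]

/-- The restriction of `ad x` to a Lie subalgebra that it preserves. -/
def adRestrict (N : LieSubalgebra K L) (x : L) (h : ∀ y ∈ N, ⁅x, y⁆ ∈ N) :
    LieDerivation K N N where
  toFun y := ⟨⁅x, (y : L)⁆, h y y.2⟩
  map_add' y z := Subtype.ext (lie_add x (y : L) (z : L))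
  map_smul' c y := Subtype.ext (lie_smul c x (y : L))
  leibniz' y z := Subtype.ext (by
    change ⁅x, ⁅(y : L), (z : L)⁆⁆ = ⁅(y : L), ⁅x, (z : L)⁆⁆ - ⁅(z : L), ⁅x, (y : L)⁆⁆
    rw [leibniz_lie, ← lie_skew (z : L) ⁅x, (y : L)⁆]
    abel)

lemma lie_mem_lieSpan_of_eigen (x : L) (s : Set L) (hs : ∀ y ∈ s, ∃ c : K, ⁅x, y⁆ = c • y) :
    ∀ y ∈ LieSubalgebra.lieSpan K L s, ⁅x, y⁆ ∈ LieSubalgebra.lieSpan K L s := by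
  intro y hy
  induction hy using LieSubalgebra.lieSpan_induction with
  | mem y h =>
    obtain ⟨c, hc⟩ := hs y h
    rw [hc]
    exact SMulMemClass.smul_mem c (LieSubalgebra.subset_lieSpan h)
  | zero => rw [lie_zero]; exact zero_mem _
  | add y z _ _ hy hz => rw [lie_add]; exact add_mem hy hz
  | smul c y _ hy => rw [lie_smul]; exact SMulMemClass.smul_mem c hy
  | lie y z h1 h2 hy hz =>
    rw [leibniz_lie]
    exact add_mem (LieSubalgebra.lie_mem _ hy h2) (LieSubalgebra.lie_mem _ h1 hz)

end Adjoint

/-! ### Kac–Moody algebras -/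

/-- A realization of an integer matrix `A` over `K`: a vector space `𝔥` with linearly independent
simple coroots in `𝔥` and linearly independent simple roots in its dual, paired by `A`. (No
minimality of the dimension of `𝔥` is imposed, so minimal realizations are included.) -/
structure Realization (K : Type*) [Field K] {V : Type*} (A : V → V → ℤ) (𝔥 : Type*)
    [AddCommGroup 𝔥] [Module K 𝔥] where
  coroot : V → 𝔥
  root : V → Module.Dual K 𝔥
  coroot_indep : LinearIndependent K coroot
  root_indep : LinearIndependent K root
  pairing : ∀ i j, root j (coroot i) = (A i j : K)

namespace Realization

/-- Generators of the Kac–Moody algebra: the elements of `𝔥` and the Chevalley generators. -/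
inductive Gen (V 𝔥 : Type*)
  | h (x : 𝔥) : Gen V 𝔥
  | e (i : V) : Gen V 𝔥
  | f (i : V) : Gen V 𝔥

variable {K : Type*} [Field K] {V : Type*} {A : V → V → ℤ} {𝔥 : Type*} [AddCommGroup 𝔥]
  [Module K 𝔥]

/-- A generator inside the free Lie algebra. -/
noncomputable def Gen.free (K : Type*) [Field K] {V 𝔥 : Type*} (g : Gen V 𝔥) :
    FreeLieAlgebra K (Gen V 𝔥) :=
  FreeLieAlgebra.of K g

variable (K V) in
/-- An element of `𝔥` inside the free Lie algebra. -/
noncomputable abbrev hF (x : 𝔥) : FreeLieAlgebra K (Gen V 𝔥) := Gen.free K (.h x)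

variable (K 𝔥) in
/-- The generator `e i` inside the free Lie algebra. -/
noncomputable abbrev eF (i : V) : FreeLieAlgebra K (Gen V 𝔥) := Gen.free K (.e i)

variable (K 𝔥) in
/-- The generator `f i` inside the free Lie algebra. -/
noncomputable abbrev fF (i : V) : FreeLieAlgebra K (Gen V 𝔥) := Gen.free K (.f i)

/-- The Chevalley–Serre relators of the Kac–Moody algebra. -/
inductive Relator (ρ : Realization K A 𝔥) : FreeLieAlgebra K (Gen V 𝔥) → Prop
  | h_add (x y : 𝔥) : Relator ρ (hF K V (x + y) - (hF K V x + hF K V y))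
  | h_smul (c : K) (x : 𝔥) : Relator ρ (hF K V (c • x) - c • hF K V x)
  | h_h (x y : 𝔥) : Relator ρ ⁅hF K V x, hF K V y⁆
  | e_f (i : V) : Relator ρ (⁅eF K 𝔥 i, fF K 𝔥 i⁆ - hF K V (ρ.coroot i))
  | e_f_ne (i j : V) (hij : i ≠ j) : Relator ρ ⁅eF K 𝔥 i, fF K 𝔥 j⁆
  | h_e (x : 𝔥) (i : V) : Relator ρ (⁅hF K V x, eF K 𝔥 i⁆ - ρ.root i x • eF K 𝔥 i)
  | h_f (x : 𝔥) (i : V) : Relator ρ (⁅hF K V x, fF K 𝔥 i⁆ - (-ρ.root i x) • fF K 𝔥 i)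
  | serre_e (i j : V) (hij : i ≠ j) : Relator ρ
      (((LieAlgebra.ad K (FreeLieAlgebra K (Gen V 𝔥)) (eF K 𝔥 i)) ^ (1 - A i j).toNat) (eF K 𝔥 j))
  | serre_f (i j : V) (hij : i ≠ j) : Relator ρ
      (((LieAlgebra.ad K (FreeLieAlgebra K (Gen V 𝔥)) (fF K 𝔥 i)) ^ (1 - A i j).toNat) (fF K 𝔥 j))

/-- The ideal generated by the Chevalley–Serre relators. -/
noncomputable def ideal (ρ : Realization K A 𝔥) : LieIdeal K (FreeLieAlgebra K (Gen V 𝔥)) :=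
  LieSubmodule.lieSpan K (FreeLieAlgebra K (Gen V 𝔥)) {x | ρ.Relator x}

/-- The Kac–Moody algebra of the realization. -/
abbrev KacMoody (ρ : Realization K A 𝔥) := FreeLieAlgebra K (Gen V 𝔥) ⧸ ρ.ideal

/-- The image of a generator in the Kac–Moody algebra. -/
noncomputable def gen (ρ : Realization K A 𝔥) (g : Gen V 𝔥) : ρ.KacMoody :=
  LieSubmodule.Quotient.mk (Gen.free K g)

lemma gen_eq_of_relator (ρ : Realization K A 𝔥) {x y : FreeLieAlgebra K (Gen V 𝔥)}
    (h : ρ.Relator (x - y)) :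
    (LieSubmodule.Quotient.mk x : ρ.KacMoody) = LieSubmodule.Quotient.mk y :=
  (Submodule.Quotient.eq _).2 (LieSubmodule.subset_lieSpan h)

lemma h_lie_e (ρ : Realization K A 𝔥) (x : 𝔥) (i : V) :
    ⁅ρ.gen (.h x), ρ.gen (.e i)⁆ = ρ.root i x • ρ.gen (.e i) :=
  ρ.gen_eq_of_relator (.h_e x i)

lemma h_lie_f (ρ : Realization K A 𝔥) (x : 𝔥) (i : V) :
    ⁅ρ.gen (.h x), ρ.gen (.f i)⁆ = (-ρ.root i x) • ρ.gen (.f i) :=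
  ρ.gen_eq_of_relator (.h_f x i)

/-- The positive subalgebra, generated by the `e i`. -/
noncomputable def nPos (ρ : Realization K A 𝔥) : LieSubalgebra K ρ.KacMoody :=
  LieSubalgebra.lieSpan K ρ.KacMoody (Set.range fun i => ρ.gen (.e i))

/-- The negative subalgebra, generated by the `f i`. -/
noncomputable def nNeg (ρ : Realization K A 𝔥) : LieSubalgebra K ρ.KacMoody :=
  LieSubalgebra.lieSpan K ρ.KacMoody (Set.range fun i => ρ.gen (.f i))

/-- The generator `e i` as an element of the positive subalgebra. -/
noncomputable def e (ρ : Realization K A 𝔥) (i : V) : ρ.nPos :=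
  ⟨ρ.gen (.e i), LieSubalgebra.subset_lieSpan ⟨i, rfl⟩⟩

/-- The generator `f i` as an element of the negative subalgebra. -/
noncomputable def f (ρ : Realization K A 𝔥) (i : V) : ρ.nNeg :=
  ⟨ρ.gen (.f i), LieSubalgebra.subset_lieSpan ⟨i, rfl⟩⟩

/-- The adjoint action of an element of `𝔥` on the positive subalgebra. -/
noncomputable def adPos (ρ : Realization K A 𝔥) (x : 𝔥) : LieDerivation K ρ.nPos ρ.nPos :=
  adRestrict ρ.nPos (ρ.gen (.h x)) (lie_mem_lieSpan_of_eigen _ _ (by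
    rintro _ ⟨i, rfl⟩
    exact ⟨_, ρ.h_lie_e x i⟩))

/-- The adjoint action of an element of `𝔥` on the negative subalgebra. -/
noncomputable def adNeg (ρ : Realization K A 𝔥) (x : 𝔥) : LieDerivation K ρ.nNeg ρ.nNeg :=
  adRestrict ρ.nNeg (ρ.gen (.h x)) (lie_mem_lieSpan_of_eigen _ _ (by
    rintro _ ⟨i, rfl⟩
    exact ⟨_, ρ.h_lie_f x i⟩))

/-- The enveloping algebra of the positive subalgebra. -/
abbrev UPos (ρ : Realization K A 𝔥) := UniversalEnvelopingAlgebra K ρ.nPos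

/-- The enveloping algebra of the negative subalgebra. -/
abbrev UNeg (ρ : Realization K A 𝔥) := UniversalEnvelopingAlgebra K ρ.nNeg

/-- The generator `e i` in the enveloping algebra. -/
noncomputable def eU (ρ : Realization K A 𝔥) (i : V) : ρ.UPos :=
  UniversalEnvelopingAlgebra.ι K (ρ.e i)

/-- The generator `f i` in the enveloping algebra. -/
noncomputable def fU (ρ : Realization K A 𝔥) (i : V) : ρ.UNeg :=
  UniversalEnvelopingAlgebra.ι K (ρ.f i)

/-- The weight `∑ d i • α i` of an element `d` of the root lattice. -/
noncomputable def weight (ρ : Realization K A 𝔥) (d : V →₀ ℤ) : Module.Dual K 𝔥 :=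
  d.sum fun i n => n • ρ.root i

/-- The weight space of `U(n⁺)` of weight `∑ d i • α i` for the adjoint action of `𝔥`. -/
noncomputable def posWeightSpace (ρ : Realization K A 𝔥) (d : V →₀ ℤ) : Submodule K ρ.UPos :=
  ⨅ x : 𝔥, LinearMap.ker (envelopingDeriv (ρ.adPos x) - ρ.weight d x • LinearMap.id)

/-- The weight space of `U(n⁻)` of weight `∑ d i • α i` for the adjoint action of `𝔥`. -/
noncomputable def negWeightSpace (ρ : Realization K A 𝔥) (d : V →₀ ℤ) : Submodule K ρ.UNeg :=
  ⨅ x : 𝔥, LinearMap.ker (envelopingDeriv (ρ.adNeg x) - ρ.weight d x • LinearMap.id)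

end Realization

/-! The algebra is studied through its actions on the polynomial ring `R`. Suppose that `X i` acts
by `g i * σ i` and `Y i` by `h i * (σ i)⁻¹`, with coefficients `g`, `h` compatible with the
relations (a `Gauge`). As `R` is a domain, words in the `X i`, `Y i` act injectively. The degree
zero component is the image of `R`, and an element of it that acts by zero vanishes. Hence a
homogeneous element of the construction dies in the quotient if and only if it acts by zero,
whichever gauge is used (`Gauge.radical_le_ker`, `Gauge.proj_eq_zero`).

The gauge may therefore depend on `i`. For each `i` there is one in which `X i` acts by `σ i` alone
and `X j` by `g j * σ j`. Here `g j` is a product of linear factors, exactly `n = -a i j` of which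
lie on edges incident to `i`. These are translated by `σ i` by a nonzero constant, the others are
fixed. In characteristic zero `(σ i - 1)^n` does not kill `g j`, but `(σ i - 1)^(n+1)` does. As `ad
(σ i)^m (g j σ j) = ((σ i - 1)^m g j) (σ i)^m σ j`, the vanishing gives the Serre relation
(`serre_X`). The nonvanishing gives the independence of the products `X i ^ m * X j * X i ^ (k - m)`
for `k ≤ n` (`X_words_indep`): evaluated at `1`, a relation between them says that a polynomial of
degree at most `n` in `σ i` kills `g j`. The `Y i` are treated in the same way.

The positive subalgebra is given inside the Kac–Moody algebra and not by a presentation, so it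
remains to see that the Serre relations suffice to map out of it. The free algebra on the `e i` is a
lowest weight Verma module over the Kac–Moody algebra without Serre relations, and the two-sided
ideal of the Serre elements is a submodule. The Kac–Moody algebra acts on the quotient, with `e i`
acting by left multiplication. The quotient maps to any algebra whose elements satisfy the Serre
relations, and applying `n⁺` to the vacuum yields the homomorphism (`exists_lieHom_lieSpan`).

Finally, independent roots in characteristic zero separate degrees, so a weight space of the
enveloping algebra is spanned by words of one degree (`mem_span_words_of_weight`). In degree `k α_i
+ α_j` these are the words `e i ^ m * e j * e i ^ (k - m)`, whose images are independent. -/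

lemma mul_mem_addSubgroupClosure {A : Type*} [Ring A] {S T U : Set A}
    (h : ∀ s ∈ S, ∀ t ∈ T, s * t ∈ U) {x y : A} (hx : x ∈ AddSubgroup.closure S)
    (hy : y ∈ AddSubgroup.closure T) : x * y ∈ AddSubgroup.closure U := by
  induction hx using AddSubgroup.closure_induction with
  | mem s hs =>
    induction hy using AddSubgroup.closure_induction with
    | mem t ht => exact AddSubgroup.subset_closure (h s hs t ht)
    | zero => simp
    | add _ _ _ _ h1 h2 => rw [mul_add]; exact add_mem h1 h2
    | neg _ _ h1 => rw [mul_neg]; exact neg_mem h1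
  | zero => simp
  | add _ _ _ _ h1 h2 => rw [add_mul]; exact add_mem h1 h2
  | neg _ _ h1 => rw [neg_mul]; exact neg_mem h1

/-! ### Normal forms and the degree zero component of the construction -/

namespace TGWDatum

section Construction

variable {K R I : Type*} [Field K] [Ring R] [Algebra K R] (D : TGWDatum K R I) (μ : I → I → Kˣ)

/-- The algebra homomorphism from the base ring to the twisted generalized Weyl construction. -/
noncomputable def coeffHom : R →ₐ[K] D.Construction μ where
  toFun r := D.cgen μ (.coeff r)
  map_one' := by
    have h := RingQuot.mkAlgHom_rel K (Rel.coeff_scalar (D := D) (μ := μ) 1)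
    rw [map_one, map_one, map_one] at h
    exact h
  map_mul' r s := by
    have h := RingQuot.mkAlgHom_rel K (Rel.coeff_mul (D := D) (μ := μ) r s)
    rw [map_mul] at h
    exact h
  map_zero' := by
    have h := RingQuot.mkAlgHom_rel K (Rel.coeff_scalar (D := D) (μ := μ) 0)
    rw [map_zero, map_zero, map_zero] at h
    exact h
  map_add' r s := by
    have h := RingQuot.mkAlgHom_rel K (Rel.coeff_add (D := D) (μ := μ) r s)
    rw [map_add] at h
    exact h
  commutes' c := by
    have h := RingQuot.mkAlgHom_rel K (Rel.coeff_scalar (D := D) (μ := μ) c)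
    rw [AlgHom.commutes] at h
    exact h

lemma cgen_coeff (r : R) : D.cgen μ (.coeff r) = D.coeffHom μ r := rfl

lemma cgen_X_mul_coeff (i : I) (r : R) :
    D.cgen μ (.X i) * D.coeffHom μ r = D.coeffHom μ (D.σ i r) * D.cgen μ (.X i) := by
  have h := RingQuot.mkAlgHom_rel K (Rel.X_coeff (D := D) (μ := μ) i r)
  rw [map_mul, map_mul] at h
  exact h

lemma cgen_Y_mul_coeff (i : I) (r : R) :
    D.cgen μ (.Y i) * D.coeffHom μ r = D.coeffHom μ ((D.σ i).symm r) * D.cgen μ (.Y i) := by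
  have h := RingQuot.mkAlgHom_rel K (Rel.Y_coeff (D := D) (μ := μ) i r)
  rw [map_mul, map_mul] at h
  exact h

lemma cgen_Y_mul_X (i : I) :
    D.cgen μ (.Y i) * D.cgen μ (.X i) = D.coeffHom μ (D.t i) := by
  have h := RingQuot.mkAlgHom_rel K (Rel.Y_X (D := D) (μ := μ) i)
  rw [map_mul] at h
  exact h

lemma cgen_X_mul_Y (i : I) :
    D.cgen μ (.X i) * D.cgen μ (.Y i) = D.coeffHom μ (D.σ i (D.t i)) := by
  have h := RingQuot.mkAlgHom_rel K (Rel.X_Y (D := D) (μ := μ) i)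
  rw [map_mul] at h
  exact h

lemma cgen_X_mul_Y_of_ne {i j : I} (hij : i ≠ j) :
    D.cgen μ (.X i) * D.cgen μ (.Y j) = (μ i j : K) • (D.cgen μ (.Y j) * D.cgen μ (.X i)) := by
  have h := RingQuot.mkAlgHom_rel K (Rel.X_Y_ne (D := D) (μ := μ) i j hij)
  rw [map_smul, map_mul, map_mul] at h
  exact h

/-- The product in the construction of a word in the generators. -/
noncomputable def word (l : List (Gen R I)) : D.Construction μ := (l.map (D.cgen μ)).prod

@[simp] lemma word_nil : D.word μ [] = 1 := rfl

@[simp] lemma word_cons (g : Gen R I) (l : List (Gen R I)) :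
    D.word μ (g :: l) = D.cgen μ g * D.word μ l := by simp [word]

@[simp] lemma word_append (l m : List (Gen R I)) :
    D.word μ (l ++ m) = D.word μ l * D.word μ m := by simp [word]

lemma word_mem_cdeg (l : List (Gen R I)) : D.word μ l ∈ D.cdeg μ (l.map Gen.deg).sum :=
  Submodule.subset_span ⟨l, rfl, rfl⟩

lemma cgen_mem_cdeg (g : Gen R I) : D.cgen μ g ∈ D.cdeg μ g.deg := by
  simpa using D.word_mem_cdeg μ [g]

lemma one_mem_cdeg : (1 : D.Construction μ) ∈ D.cdeg μ 0 := D.word_mem_cdeg μ []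

lemma mul_mem_cdeg {x y : D.Construction μ} {c d : I →₀ ℤ} (hx : x ∈ D.cdeg μ c)
    (hy : y ∈ D.cdeg μ d) : x * y ∈ D.cdeg μ (c + d) := by
  have h := Submodule.mul_mem_mul hx hy
  rw [cdeg, cdeg, Submodule.span_mul_span] at h
  refine Submodule.span_mono ?_ h
  rintro _ ⟨_, ⟨l, rfl, rfl⟩, _, ⟨m, rfl, rfl⟩, rfl⟩
  exact ⟨l ++ m, by simp, by simp⟩

lemma mem_closure_homogeneous (x : D.Construction μ) :
    x ∈ AddSubgroup.closure {y | ∃ d, y ∈ D.cdeg μ d} := by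
  obtain ⟨x, rfl⟩ := RingQuot.mkAlgHom_surjective K (D.Rel μ) x
  induction x using FreeAlgebra.induction with
  | grade0 c =>
    refine AddSubgroup.subset_closure ⟨0, ?_⟩
    rw [AlgHom.commutes, Algebra.algebraMap_eq_smul_one]
    exact Submodule.smul_mem _ _ (D.one_mem_cdeg μ)
  | grade1 g => exact AddSubgroup.subset_closure ⟨_, D.cgen_mem_cdeg μ g⟩
  | mul a b ha hb =>
    rw [map_mul]
    refine mul_mem_addSubgroupClosure ?_ ha hb
    rintro y ⟨c, hy⟩ z ⟨d, hz⟩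
    exact ⟨_, D.mul_mem_cdeg μ hy hz⟩
  | add a b ha hb => rw [map_add]; exact add_mem ha hb

/-- A product of generators can be reordered so that coefficients come first, then the `Y i`, then
the `X i`. -/
lemma exists_word_eq (l : List (Gen R I)) : ∃ (r : R) (y x : List I),
    D.word μ l = D.coeffHom μ r * D.word μ (y.map .Y) * D.word μ (x.map .X) ∧
    (l.map Gen.deg).sum = ((y.map (Gen.Y (R := R))).map Gen.deg).sum +
      ((x.map (Gen.X (R := R))).map Gen.deg).sum := by
  -- An `X i` travels right through the `Y`-word. It either meets a `Y i` and turns into a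
  -- coefficient, or joins the `X`-word.
  have key : ∀ (i : I) (y x : List I), ∃ (r : R) (y' x' : List I),
      D.cgen μ (.X i) * (D.word μ (y.map .Y) * D.word μ (x.map .X)) =
        D.coeffHom μ r * D.word μ (y'.map .Y) * D.word μ (x'.map .X) ∧
      Finsupp.single i 1 + (((y.map (Gen.Y (R := R))).map Gen.deg).sum +
        ((x.map (Gen.X (R := R))).map Gen.deg).sum) =
      ((y'.map (Gen.Y (R := R))).map Gen.deg).sum +
        ((x'.map (Gen.X (R := R))).map Gen.deg).sum := by
    intro i y x
    induction y with
    | nil => exact ⟨1, [], i :: x, by simp, by simp [Gen.deg]⟩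
    | cons j y ih =>
      by_cases hij : i = j
      · subst hij
        refine ⟨D.σ i (D.t i), y, x, ?_, ?_⟩
        · simp only [List.map_cons, word_cons, ← mul_assoc]
          rw [cgen_X_mul_Y]
        · simp only [List.map_cons, List.sum_cons, Gen.deg, Finsupp.single_neg]
          abel
      · obtain ⟨r, y', x', h1, h2⟩ := ih
        refine ⟨(μ i j : K) • (D.σ j).symm r, j :: y', x', ?_, ?_⟩
        · simp only [List.map_cons, word_cons]
          rw [mul_assoc (D.cgen μ (.Y j)), ← mul_assoc, cgen_X_mul_Y_of_ne _ _ hij, smul_mul_assoc,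
            mul_assoc, h1, ← mul_assoc, ← mul_assoc, cgen_Y_mul_coeff, map_smul, smul_mul_assoc,
            smul_mul_assoc]
          simp only [mul_assoc]
        · simp only [List.map_cons, List.sum_cons]
          rw [add_assoc, add_left_comm, h2, add_assoc]
  induction l with
  | nil => exact ⟨1, [], [], by simp, by simp⟩
  | cons g l ih =>
    obtain ⟨r, y, x, h1, h2⟩ := ih
    cases g with
    | coeff s =>
      refine ⟨s * r, y, x, ?_, ?_⟩
      · rw [word_cons, h1, cgen_coeff, map_mul]
        simp only [mul_assoc]
      · simp [Gen.deg, h2]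
    | Y i =>
      refine ⟨(D.σ i).symm r, i :: y, x, ?_, ?_⟩
      · rw [word_cons, h1, ← mul_assoc, ← mul_assoc, cgen_Y_mul_coeff]
        simp only [List.map_cons, word_cons, mul_assoc]
      · rw [List.map_cons, List.sum_cons, h2, List.map_cons, List.map_cons, List.sum_cons,
          add_assoc]
    | X i =>
      obtain ⟨s, y', x', h3, h4⟩ := key i y x
      refine ⟨D.σ i r * s, y', x', ?_, ?_⟩
      · rw [word_cons, h1, mul_assoc, ← mul_assoc, cgen_X_mul_coeff, mul_assoc, h3, map_mul]
        simp only [mul_assoc]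
      · rw [List.map_cons, List.sum_cons, h2]
        exact h4

/-- `Y i` moves past each `X j` with `j ≠ i` at the cost of a unit, until the first `X i`, where the
pair becomes `t i`. This coefficient is then carried back to the left. -/
lemma exists_Y_mul_word_X (i : I) : ∀ x : List I, i ∈ x → ∃ (r : R) (x' : List I),
    D.cgen μ (.Y i) * D.word μ (x.map .X) = D.coeffHom μ r * D.word μ (x'.map .X) ∧
    ((x.map (Gen.X (R := R))).map Gen.deg).sum = Finsupp.single i 1 +
      ((x'.map (Gen.X (R := R))).map Gen.deg).sum := by
  intro x hx
  induction x with
  | nil => simp at hx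
  | cons j x ih =>
    by_cases hij : i = j
    · subst hij
      refine ⟨D.t i, x, ?_, by simp [Gen.deg]⟩
      rw [List.map_cons, word_cons, ← mul_assoc, cgen_Y_mul_X]
    · obtain ⟨r, x', h1, h2⟩ := ih (by simpa [hij] using hx)
      refine ⟨((μ j i)⁻¹ : Kˣ).val • D.σ j r, j :: x', ?_, ?_⟩
      · have h := D.cgen_X_mul_Y_of_ne μ (Ne.symm hij)
        replace h : D.cgen μ (.Y i) * D.cgen μ (.X j) =
            ((μ j i)⁻¹ : Kˣ).val • (D.cgen μ (.X j) * D.cgen μ (.Y i)) := by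
          rw [h, smul_smul, Units.inv_mul, one_smul]
        rw [List.map_cons, word_cons, ← mul_assoc, h, smul_mul_assoc, mul_assoc, h1, ← mul_assoc,
          cgen_X_mul_coeff, map_smul, List.map_cons, word_cons, smul_mul_assoc, mul_assoc]
      · simp only [List.map_cons, List.sum_cons]
        rw [h2]
        abel

/-- In total degree zero every index occurs equally often in both words, so the letters cancel in
pairs. -/
lemma word_Y_mul_word_X_mem_range : ∀ (y x : List I),
    ((y.map (Gen.Y (R := R))).map Gen.deg).sum +
      ((x.map (Gen.X (R := R))).map Gen.deg).sum = 0 →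
    ∃ r : R, D.word μ (y.map .Y) * D.word μ (x.map .X) = D.coeffHom μ r := by
  classical
  have hX : ∀ (x : List I) (i : I),
      ((x.map (Gen.X (R := R))).map Gen.deg).sum i = (x.count i : ℤ) := by
    intro x i
    induction x with
    | nil => simp
    | cons j x ih =>
      simp only [List.map_cons, List.sum_cons, Finsupp.add_apply, ih, Gen.deg, List.count_cons,
        Finsupp.single_apply]
      split_ifs <;> simp_all [add_comm]
  have hY : ∀ (y : List I) (i : I),
      ((y.map (Gen.Y (R := R))).map Gen.deg).sum i = -(y.count i : ℤ) := by
    intro y i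
    induction y with
    | nil => simp
    | cons j x ih =>
      simp only [List.map_cons, List.sum_cons, Finsupp.add_apply, ih, Gen.deg, List.count_cons,
        Finsupp.single_apply]
      split_ifs <;> simp_all [add_comm]
  intro y
  -- The letters of `y` are removed from the right, because the last one is adjacent to the
  -- `X`-word.
  induction y using List.reverseRecOn with
  | nil =>
    intro x h
    have hx : x = [] := by
      refine List.eq_nil_iff_forall_not_mem.2 fun i hi => ?_
      have h2 := DFunLike.congr_fun h i
      rw [Finsupp.add_apply, hX] at h2
      have := List.count_pos_iff.2 hi
      simp at h2
      omega
    exact ⟨1, by simp [hx]⟩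
  | append_singleton y i ih =>
    intro x h
    have hi : i ∈ x := by
      have h2 := DFunLike.congr_fun h i
      rw [Finsupp.add_apply, hX, hY, List.count_append] at h2
      simp at h2
      exact List.count_pos_iff.1 (by omega)
    obtain ⟨r, x', h1, h2⟩ := D.exists_Y_mul_word_X μ i x hi
    have hmove : ∀ y : List I, ∃ s : R,
        D.word μ (y.map .Y) * D.coeffHom μ r = D.coeffHom μ s * D.word μ (y.map .Y) := by
      intro y
      induction y with
      | nil => exact ⟨r, by simp⟩
      | cons j y ih =>
        obtain ⟨s, hs⟩ := ih
        exact ⟨(D.σ j).symm s, by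
          rw [List.map_cons, word_cons, mul_assoc, hs, ← mul_assoc, cgen_Y_mul_coeff, mul_assoc]⟩
    obtain ⟨s, hs⟩ := hmove y
    obtain ⟨q, hq⟩ := ih x' (by
      rw [h2] at h
      simp only [List.map_append, List.sum_append, List.map_cons, List.map_nil, List.sum_cons,
        List.sum_nil, Gen.deg, Finsupp.single_neg] at h
      rw [← h]
      abel)
    refine ⟨s * q, ?_⟩
    rw [List.map_append, word_append, List.map_singleton, word_cons, word_nil, mul_one, mul_assoc,
      h1, ← mul_assoc, hs, mul_assoc, hq, map_mul]

/-- The degree zero component is the image of the base ring. -/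
lemma exists_coeff_of_mem_cdeg_zero {x : D.Construction μ} (hx : x ∈ D.cdeg μ 0) :
    ∃ r, x = D.coeffHom μ r := by
  have hle : D.cdeg μ 0 ≤ LinearMap.range (D.coeffHom μ).toLinearMap := by
    refine Submodule.span_le.2 ?_
    rintro _ ⟨l, hl, rfl⟩
    obtain ⟨r, y, x, h1, h2⟩ := D.exists_word_eq μ l
    obtain ⟨s, hs⟩ := D.word_Y_mul_word_X_mem_range μ y x (by rw [← h2, hl])
    refine ⟨r * s, ?_⟩
    change D.coeffHom μ (r * s) = D.word μ l
    rw [h1, mul_assoc, hs, map_mul]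
  obtain ⟨r, hr⟩ := hle hx
  exact ⟨r, hr.symm⟩

end Construction

/-- The word must avoid coefficients: multiplication by it then shifts a homogeneous element to
degree zero and still acts injectively. -/
lemma exists_word_of_degree {R I : Type*} (d : I →₀ ℤ) : ∃ l : List (Gen R I),
    (l.map Gen.deg).sum = d ∧ ∀ g ∈ l, (∃ i, g = .X i) ∨ ∃ i, g = .Y i := by
  induction d using Finsupp.induction_linear with
  | zero => exact ⟨[], by simp⟩
  | add c d hc hd =>
    obtain ⟨l, hl, hl'⟩ := hc
    obtain ⟨m, hm, hm'⟩ := hd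
    refine ⟨l ++ m, by simp [hl, hm], fun g hg => ?_⟩
    rcases List.mem_append.1 hg with h | h
    exacts [hl' g h, hm' g h]
  | single i n =>
    obtain ⟨n, rfl | rfl⟩ := n.eq_nat_or_neg
    · refine ⟨List.replicate n (.X i), by simp [Gen.deg], fun g hg => ?_⟩
      exact .inl ⟨i, List.eq_of_mem_replicate hg⟩
    · refine ⟨List.replicate n (.Y i), by simp [Gen.deg], fun g hg => ?_⟩
      exact .inr ⟨i, List.eq_of_mem_replicate hg⟩

/-! ### Representations on the base ring and the radical -/

section Representation

variable {K R I : Type*} [Field K] [CommRing R] [Algebra K R] (D : TGWDatum K R I)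

/-- The operator `r ↦ a * τ r` on a commutative algebra. -/
noncomputable def twistedMul (a : R) (τ : R →ₗ[K] R) : Module.End K R :=
  LinearMap.mulLeft K a ∘ₗ τ

@[simp] lemma twistedMul_apply (a : R) (τ : R →ₗ[K] R) (r : R) :
    twistedMul a τ r = a * τ r := rfl

/-- Coefficients `g i`, `h i` such that `X i ↦ g i * σ i`, `Y i ↦ h i * (σ i)⁻¹` defines an action of
the construction on the base ring. -/
structure Gauge where
  g : I → R
  h : I → R
  Y_X : ∀ i, h i * (D.σ i).symm (g i) = D.t i
  X_Y : ∀ i j, i ≠ j → g i * D.σ i (h j) = h j * (D.σ j).symm (g i)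

variable {D} (G : D.Gauge)

/-- The action of the generators given by a gauge. -/
noncomputable def Gauge.op : Gen R I → Module.End K R
  | .coeff r => LinearMap.mulLeft K r
  | .X i => twistedMul (G.g i) (D.σ i).toLinearMap
  | .Y i => twistedMul (G.h i) (D.σ i).symm.toLinearMap

/-- The representation of the construction on the base ring given by a gauge. -/
noncomputable def Gauge.rep : D.Construction (fun _ _ => 1) →ₐ[K] Module.End K R :=
  RingQuot.liftAlgHom K ⟨FreeAlgebra.lift K G.op, by
    have hcomm : ∀ i j r, (D.σ i) ((D.σ j).symm r) = (D.σ j).symm (D.σ i r) := by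
      intro i j r
      apply (D.σ j).injective
      rw [AlgEquiv.apply_symm_apply, ← D.σ_comm, AlgEquiv.apply_symm_apply]
    intro x y h
    cases h with
    | coeff_add r s =>
      ext m
      simp [Gen.free, Gauge.op, add_mul]
    | coeff_mul r s =>
      ext m
      simp [Gen.free, Gauge.op]
    | coeff_scalar c =>
      ext m
      simp [Gen.free, Gauge.op, Algebra.smul_def]
    | X_coeff i r =>
      ext m
      simp [Gen.free, Gauge.op, mul_left_comm]
    | Y_coeff i r =>
      ext m
      simp [Gen.free, Gauge.op, mul_left_comm]
    | Y_X i =>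
      ext m
      simp [Gen.free, Gauge.op, ← G.Y_X i]
    | X_Y i =>
      ext m
      simp [Gen.free, Gauge.op, ← G.Y_X i]
      ring
    | X_Y_ne i j hij =>
      ext m
      simp only [Gen.free, map_mul, FreeAlgebra.lift_ι_apply, Gauge.op, Units.val_one, one_smul,
        Module.End.mul_apply, twistedMul_apply, AlgEquiv.toLinearMap_apply, map_mul]
      rw [← mul_assoc, ← mul_assoc, G.X_Y i j hij, hcomm]⟩

lemma Gauge.rep_cgen (x : Gen R I) : G.rep (D.cgen _ x) = G.op x := by
  rw [Gauge.rep, cgen, RingQuot.liftAlgHom_mkAlgHom_apply, Gen.free, FreeAlgebra.lift_ι_apply]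

lemma Gauge.rep_coeffHom (r : R) : G.rep (D.coeffHom _ r) = LinearMap.mulLeft K r :=
  G.rep_cgen (.coeff r)

lemma Gauge.eq_zero_of_mem_cdeg_zero {x : D.Construction (fun _ _ => 1)}
    (hx : x ∈ D.cdeg (fun _ _ => 1) 0) (h : G.rep x = 0) : x = 0 := by
  obtain ⟨r, rfl⟩ := D.exists_coeff_of_mem_cdeg_zero _ hx
  rw [G.rep_coeffHom] at h
  have h1 := LinearMap.congr_fun h 1
  simp only [LinearMap.mulLeft_apply, mul_one, LinearMap.zero_apply] at h1
  rw [h1, map_zero]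

/-- Each letter acts by an automorphism followed by multiplication by `g i` or `h i`. These are
nonzero because `t i` is nonzero and equals `h i` times a translate of `g i`. -/
lemma Gauge.rep_word_injective [IsDomain R] (l : List (Gen R I))
    (hl : ∀ g ∈ l, (∃ i, g = .X i) ∨ ∃ i, g = .Y i) : Function.Injective (G.rep (D.word _ l)) := by
  have hne : ∀ i, G.g i ≠ 0 ∧ G.h i ≠ 0 := by
    intro i
    constructor
    · intro h
      apply D.t_ne_zero i
      rw [← G.Y_X, h, map_zero, mul_zero]
    · intro h
      apply D.t_ne_zero i
      rw [← G.Y_X, h, zero_mul]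
  induction l with
  | nil => exact fun _ _ h => by simpa using h
  | cons g l ih =>
    rw [word_cons, map_mul, Module.End.mul_eq_comp, LinearMap.coe_comp]
    refine Function.Injective.comp ?_ (ih fun g hg => hl g (List.mem_cons_of_mem _ hg))
    rw [G.rep_cgen]
    rcases hl g List.mem_cons_self with ⟨i, rfl⟩ | ⟨i, rfl⟩
    · exact (mul_right_injective₀ (hne i).1).comp (D.σ i).injective
    · exact (mul_right_injective₀ (hne i).2).comp (D.σ i).symm.injective

/-- Multiplying a homogeneous element of an admissible ideal by a word of opposite degree lands in
the degree zero part of the ideal, which is zero. The word acts injectively, so the element itself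
acts by zero. -/
lemma Gauge.radical_le_ker [IsDomain R] :
    D.radical (fun _ _ => 1) ≤ TwoSidedIdeal.ker G.rep := by
  refine sSup_le ?_
  rintro J ⟨hJ, hJ0⟩ x hx
  rw [TwoSidedIdeal.mem_ker]
  suffices hle : AddSubgroup.closure {y | y ∈ J ∧ ∃ d, y ∈ D.cdeg (fun _ _ => 1) d} ≤
      (G.rep : _ →+ Module.End K R).ker from hle (hJ x hx)
  refine (AddSubgroup.closure_le _).2 ?_
  rintro y ⟨hyJ, d, hyd⟩
  obtain ⟨l, hl, hl'⟩ := exists_word_of_degree (R := R) (-d)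
  have h0 : D.word (fun _ _ => 1) l * y = 0 := by
    refine hJ0 _ (J.mul_mem_left _ _ hyJ) ?_
    have h := D.mul_mem_cdeg _ (D.word_mem_cdeg (fun _ _ => 1) l) hyd
    rwa [hl, neg_add_cancel] at h
  have h1 := congrArg G.rep h0
  rw [map_mul, map_zero] at h1
  refine LinearMap.ext fun m => G.rep_word_injective l hl' ?_
  rw [LinearMap.zero_apply, map_zero]
  exact LinearMap.congr_fun h1 m

lemma Gauge.rep_eq_zero_of_proj_eq_zero [IsDomain R] {x : D.Construction (fun _ _ => 1)}
    (hx : D.proj (fun _ _ => 1) x = 0) : G.rep x = 0 := by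
  rw [← TwoSidedIdeal.mem_ker]
  apply G.radical_le_ker
  rw [TwoSidedIdeal.mem_iff]
  rw [← map_zero (D.proj fun _ _ => 1)] at hx
  exact Quotient.exact hx

/-- A homogeneous element that acts by zero in the representation of a gauge vanishes in the
twisted generalized Weyl algebra. -/
lemma Gauge.proj_eq_zero {x : D.Construction (fun _ _ => 1)} {d : I →₀ ℤ}
    (hxd : x ∈ D.cdeg (fun _ _ => 1) d) (hx : G.rep x = 0) : D.proj (fun _ _ => 1) x = 0 := by
  let S : Set (D.Construction (fun _ _ => 1)) :=
    {y | G.rep y = 0 ∧ ∃ d, y ∈ D.cdeg (fun _ _ => 1) d}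
  -- The additive span of the homogeneous elements acting by zero is an ideal, since every element
  -- of the construction is a sum of homogeneous ones. It meets degree zero trivially, hence lies in
  -- the radical.
  let J : TwoSidedIdeal (D.Construction (fun _ _ => 1)) :=
    TwoSidedIdeal.mk' (AddSubgroup.closure S) (zero_mem _) add_mem neg_mem
      (fun {a} {y} hy => mul_mem_addSubgroupClosure
        (by
          rintro b ⟨c, hb⟩ z ⟨h0, d, hz⟩
          exact ⟨by rw [map_mul, h0, mul_zero], _, D.mul_mem_cdeg _ hb hz⟩)
        (D.mem_closure_homogeneous _ a) hy)
      (fun {y} {a} hy => mul_mem_addSubgroupClosure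
        (by
          rintro z ⟨h0, d, hz⟩ b ⟨c, hb⟩
          exact ⟨by rw [map_mul, h0, zero_mul], _, D.mul_mem_cdeg _ hz hb⟩)
        hy (D.mem_closure_homogeneous _ a))
  have hJ : ∀ y, y ∈ J ↔ y ∈ AddSubgroup.closure S := by
    intro y
    rw [TwoSidedIdeal.mem_mk']
    rfl
  have hJker : ∀ y ∈ J, G.rep y = 0 := by
    intro y hy
    have hle : AddSubgroup.closure S ≤ (G.rep : _ →+ Module.End K R).ker :=
      (AddSubgroup.closure_le _).2 fun z hz => hz.1
    exact hle ((hJ y).1 hy)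
  have hmem : x ∈ D.radical (fun _ _ => 1) := by
    refine (le_sSup (a := J) ⟨?_, ?_⟩ : J ≤ D.radical (fun _ _ => 1)) ((hJ x).2 (AddSubgroup.subset_closure ⟨hx, d, hxd⟩))
    · intro y hy
      refine AddSubgroup.closure_mono ?_ ((hJ y).1 hy)
      rintro z ⟨hz, hzd⟩
      exact ⟨(hJ z).2 (AddSubgroup.subset_closure ⟨hz, hzd⟩), hzd⟩
    · intro y hy hy0
      exact G.eq_zero_of_mem_cdeg_zero hy0 (hJker y hy)
  rw [← map_zero (D.proj fun _ _ => 1)]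
  exact Quotient.sound hmem

end Representation

end TGWDatum

/-! ### Rising and falling products -/

section FactorialProducts

variable {A : Type*} [CommRing A]

/-- The rising product `x (x + 1) ⋯ (x + n - 1)`. -/
def risingProd (x : A) (n : ℕ) : A := ∏ k ∈ Finset.range n, (x + (k : A))

/-- The product `(x - 1) (x - 2) ⋯ (x - n)`. -/
def fallingProd (x : A) (n : ℕ) : A := ∏ k ∈ Finset.range n, (x - ((k : A) + 1))

@[simp] lemma risingProd_zero (x : A) : risingProd x 0 = 1 := rfl

@[simp] lemma fallingProd_zero (x : A) : fallingProd x 0 = 1 := rfl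

lemma map_risingProd {B F : Type*} [CommRing B] [FunLike F A B] [RingHomClass F A B] (f : F)
    (x : A) (n : ℕ) : f (risingProd x n) = risingProd (f x) n := by
  simp [risingProd, map_prod]

lemma map_fallingProd {B F : Type*} [CommRing B] [FunLike F A B] [RingHomClass F A B] (f : F)
    (x : A) (n : ℕ) : f (fallingProd x n) = fallingProd (f x) n := by
  simp [fallingProd, map_prod]

lemma risingProd_add (x : A) (m n : ℕ) :
    risingProd x (m + n) = risingProd x m * risingProd (x + m) n := by
  simp only [risingProd, Finset.prod_range_add]
  congr 1
  refine Finset.prod_congr rfl fun k _ => ?_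
  push_cast
  ring

lemma fallingProd_add (x : A) (m n : ℕ) :
    fallingProd x (m + n) = fallingProd x m * fallingProd (x - m) n := by
  simp only [fallingProd, Finset.prod_range_add]
  congr 1
  refine Finset.prod_congr rfl fun k _ => ?_
  push_cast
  ring

/-- Reversal of the order of the factors. It turns the coefficient of one end of an edge into that
of the other end after a shift. -/
lemma risingProd_sub (x : A) (n : ℕ) : risingProd (x - n) n = fallingProd x n := by
  rw [risingProd, fallingProd, ← Finset.prod_range_reflect]
  refine Finset.prod_congr rfl fun k hk => ?_
  have h : n - 1 - k + (k + 1) = n := by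
    have := Finset.mem_range.1 hk
    omega
  have h2 : ((n - 1 - k : ℕ) : A) + ((k : A) + 1) = n := by exact_mod_cast congrArg (Nat.cast) h
  linear_combination h2

lemma fallingProd_add_self (x : A) (n : ℕ) : fallingProd (x + n) n = risingProd x n := by
  rw [← risingProd_sub, add_sub_cancel_right]

end FactorialProducts

/-! ### Degree with respect to a difference operator -/

section DifferenceDegree

variable {K R : Type*} [Field K] [CommRing R] [Algebra K R]

/-- The element `p` has degree exactly `n` with respect to the difference operator `τ - 1`. -/
def HasDiffDegree (τ : R →ₗ[K] R) (n : ℕ) (p : R) : Prop :=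
  ((τ - 1) ^ n : Module.End K R) p ≠ 0 ∧ ((τ - 1) ^ (n + 1) : Module.End K R) p = 0

lemma hasDiffDegree_one [Nontrivial R] (τ : R →ₐ[K] R) :
    HasDiffDegree τ.toLinearMap 0 (1 : R) := by
  simp [HasDiffDegree]

lemma HasDiffDegree.mul_invariant [IsDomain R] {τ : R →ₐ[K] R} {n : ℕ} {p q : R}
    (hp : HasDiffDegree τ.toLinearMap n p) (hq : q ≠ 0) (hτ : τ q = q) :
    HasDiffDegree τ.toLinearMap n (q * p) := by
  have key : ∀ k, ((τ.toLinearMap - 1) ^ k : Module.End K R) (q * p) =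
      q * ((τ.toLinearMap - 1) ^ k : Module.End K R) p := by
    intro k
    induction k with
    | zero => simp
    | succ k ih => simp [pow_succ', ih, hτ, mul_sub]
  exact ⟨by rw [key]; exact mul_ne_zero hq hp.1, by rw [key, hp.2, mul_zero]⟩

/-- A discrete Leibniz rule: the leading difference of `ℓ * p` is `(n + 1) * b` times a translate of
that of `p`. Characteristic zero keeps the factor `n + 1` from vanishing. -/
lemma HasDiffDegree.mul_linear [CharZero K] {τ : R →ₐ[K] R} (hinj : Function.Injective τ) {n : ℕ}
    {p ℓ : R} {b : K} (hb : b ≠ 0) (hτ : τ ℓ = ℓ + algebraMap K R b)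
    (hp : HasDiffDegree τ.toLinearMap n p) :
    HasDiffDegree τ.toLinearMap (n + 1) (ℓ * p) := by
  have key : ∀ k : ℕ, ((τ.toLinearMap - 1) ^ (k + 1) : Module.End K R) (ℓ * p) =
      ℓ * ((τ.toLinearMap - 1) ^ (k + 1) : Module.End K R) p +
        (((k + 1 : ℕ) : K) * b) • τ (((τ.toLinearMap - 1) ^ k : Module.End K R) p) := by
    intro k
    induction k with
    | zero =>
      simp [hτ, Algebra.smul_def]
      ring
    | succ k ih =>
      have hs : ∀ (m : ℕ) (x : R), ((τ.toLinearMap - 1) ^ (m + 1) : Module.End K R) x =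
          τ (((τ.toLinearMap - 1) ^ m : Module.End K R) x) -
            ((τ.toLinearMap - 1) ^ m : Module.End K R) x := by
        intro m x
        rw [pow_succ']
        rfl
      rw [hs (k + 1) (ℓ * p), ih, hs (k + 1) p, hs k p]
      simp only [map_add, map_mul, hτ, map_sub, Algebra.smul_def, map_natCast, AlgHom.commutes]
      push_cast
      ring
  refine ⟨?_, ?_⟩
  · rw [key, hp.2, mul_zero, zero_add]
    refine smul_ne_zero (mul_ne_zero (Nat.cast_ne_zero.2 n.succ_ne_zero) hb) ?_
    exact (map_ne_zero_iff τ hinj).2 hp.1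
  · rw [key, hp.2, map_zero, smul_zero, pow_succ', Module.End.mul_apply, hp.2, map_zero, mul_zero,
      zero_add]

lemma HasDiffDegree.mul_prod [CharZero K] {τ : R →ₐ[K] R} (hinj : Function.Injective τ) {n : ℕ}
    {p : R} {b : K} (hb : b ≠ 0) {ι : Type*} (s : Finset ι) {ℓ : ι → R}
    (hτ : ∀ i ∈ s, τ (ℓ i) = ℓ i + algebraMap K R b) (hp : HasDiffDegree τ.toLinearMap n p) :
    HasDiffDegree τ.toLinearMap (s.card + n) ((∏ i ∈ s, ℓ i) * p) := by
  classical
  induction s using Finset.induction_on with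
  | empty => simpa using hp
  | insert i s hi ih =>
    rw [Finset.card_insert_of_notMem hi, Finset.prod_insert hi, mul_assoc, Nat.succ_add]
    exact (ih fun j hj => hτ j (Finset.mem_insert_of_mem hj)).mul_linear hinj hb
      (hτ i (Finset.mem_insert_self _ _))

lemma hasDiffDegree_prod [Nontrivial R] {τ : R →ₐ[K] R} {ι : Type*} (s : Finset ι) {f : ι → R}
    {d : ι → ℕ} (h : ∀ i ∈ s, ∀ n p, HasDiffDegree τ.toLinearMap n p →
      HasDiffDegree τ.toLinearMap (d i + n) (f i * p)) :
    HasDiffDegree τ.toLinearMap (∑ i ∈ s, d i) (∏ i ∈ s, f i) := by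
  classical
  induction s using Finset.induction_on with
  | empty => simpa using hasDiffDegree_one τ
  | insert i s hi ih =>
    rw [Finset.sum_insert hi, Finset.prod_insert hi]
    exact h i (Finset.mem_insert_self _ _) _ _ (ih fun j hj => h j (Finset.mem_insert_of_mem hj))

/-- The translates of an element of degree `n` satisfy no polynomial relation of degree at most
`n`. -/
lemma HasDiffDegree.eq_zero_of_aeval {τ : R →ₗ[K] R} {n : ℕ} {p : R} (hp : HasDiffDegree τ n p)
    {q : Polynomial K} (hq : q.natDegree ≤ n)
    (h : (Polynomial.aeval (R := K) (A := Module.End K R) τ q) p = 0) : q = 0 := by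
  by_contra hq0
  obtain ⟨r, hr, hdvd⟩ := Polynomial.exists_eq_pow_rootMultiplicity_mul_and_not_dvd q hq0 1
  set m := q.rootMultiplicity 1 with hm
  -- The bound on the degree of `q` enters only here: the root `1` has multiplicity at most `n`.
  have hmn : m ≤ n := by
    refine le_trans ?_ hq
    have h := Polynomial.natDegree_le_of_dvd (Polynomial.pow_rootMultiplicity_dvd q 1) hq0
    rwa [Polynomial.natDegree_pow, Polynomial.natDegree_X_sub_C, mul_one] at h
  set a := ((τ - 1) ^ n : Module.End K R) p with ha
  have hτa : τ a = (1 : K) • a := by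
    have h2 := hp.2
    rw [pow_succ', Module.End.mul_apply, LinearMap.sub_apply, Module.End.one_apply,
      sub_eq_zero] at h2
    rw [one_smul]
    exact h2
  have h1 : (Polynomial.aeval (R := K) (A := Module.End K R) τ r) a = r.eval 1 • a :=
    Module.End.aeval_apply_of_hasEigenvector ⟨Module.End.mem_eigenspace_iff.2 hτa, hp.1⟩
  -- Raising the multiplicity of the root to exactly `n` turns the relation into `r(τ)` applied to
  -- the `n`-th difference `a`, which `τ` fixes. So `r` acts by the nonzero scalar `r(1)`.
  have h2 : (Polynomial.aeval (R := K) (A := Module.End K R) τ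
      ((Polynomial.X - Polynomial.C 1) ^ (n - m) * q)) p = r.eval 1 • a := by
    rw [hr, ← mul_assoc, ← pow_add, Nat.sub_add_cancel hmn, mul_comm, map_mul, Module.End.mul_apply,
      ← h1, ha]
    simp
  rw [map_mul, Module.End.mul_apply, h, map_zero] at h2
  rcases smul_eq_zero.1 h2.symm with h3 | h3
  · exact hdvd (Polynomial.dvd_iff_isRoot.2 h3)
  · exact hp.1 h3

end DifferenceDegree

/-! ### Serre expressions in a gauge -/

namespace TGWDatum

attribute [local instance] LieRing.ofAssociativeRing

section

variable {K R I : Type*} [Field K] [CommRing R] [Algebra K R] {D : TGWDatum K R I}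

/-- One commutator is `τ ∘ (p υ) - (p υ) ∘ τ = ((τ - 1) p) τ υ`, because `τ` and `υ` commute;
iterate. -/
lemma ad_pow_twistedMul {τ υ : R →ₐ[K] R} (hcomm : ∀ r, τ (υ r) = υ (τ r)) (p : R) (n : ℕ) :
    ((LieAlgebra.ad K (Module.End K R) τ.toLinearMap) ^ n) (twistedMul p υ.toLinearMap) =
      twistedMul (((τ.toLinearMap - 1) ^ n : Module.End K R) p)
        ((τ.toLinearMap ^ n : Module.End K R) * υ.toLinearMap) := by
  have hc : ∀ (n : ℕ) r, (τ.toLinearMap ^ n : Module.End K R) (υ (τ r)) =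
      τ ((τ.toLinearMap ^ n : Module.End K R) (υ r)) := by
    intro n r
    rw [← hcomm, ← AlgHom.toLinearMap_apply τ (υ r), ← Module.End.mul_apply, ← pow_succ, pow_succ']
    rfl
  induction n with
  | zero => rfl
  | succ n ih =>
    rw [pow_succ', Module.End.mul_apply, ih, LieAlgebra.ad_apply, LieRing.of_associative_ring_bracket]
    ext r
    simp only [LinearMap.sub_apply, Module.End.mul_apply, twistedMul_apply,
      AlgHom.toLinearMap_apply, map_mul, pow_succ', Module.End.one_apply, hc]
    ring

lemma ad_pow_mem_cdeg {μ : I → I → Kˣ} {x y : D.Construction μ} {c d : I →₀ ℤ}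
    (hx : x ∈ D.cdeg μ c) (hy : y ∈ D.cdeg μ d) (n : ℕ) :
    ((LieAlgebra.ad K (D.Construction μ) x) ^ n) y ∈ D.cdeg μ (n • c + d) := by
  induction n with
  | zero => simpa using hy
  | succ n ih =>
    rw [pow_succ', Module.End.mul_apply, LieAlgebra.ad_apply, LieRing.of_associative_ring_bracket]
    refine sub_mem ?_ ?_
    · rw [succ_nsmul', add_assoc]
      exact D.mul_mem_cdeg μ hx ih
    · rw [succ_nsmul, add_right_comm]
      exact D.mul_mem_cdeg μ ih hx

lemma map_ad_pow {A B : Type*} [Ring A] [Ring B] [Algebra K A] [Algebra K B] (f : A →ₐ[K] B)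
    (x y : A) (n : ℕ) :
    f (((LieAlgebra.ad K A x) ^ n) y) = ((LieAlgebra.ad K B (f x)) ^ n) (f y) := by
  induction n with
  | zero => rfl
  | succ n ih =>
    simp only [pow_succ', Module.End.mul_apply, LieAlgebra.ad_apply,
      LieRing.of_associative_ring_bracket, map_sub, map_mul, ih]

variable (G : D.Gauge) {a b : Gen R I} {τ υ : R →ₐ[K] R} {p : R} {n : ℕ}

include G in
/-- Two generators satisfy a Serre relation in the twisted generalized Weyl algebra, if one of them
acts by an automorphism and the coefficient of the other one has bounded degree. -/
lemma Gauge.serre (ha : G.op a = τ.toLinearMap) (hb : G.op b = twistedMul p υ.toLinearMap)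
    (hcomm : ∀ r, τ (υ r) = υ (τ r)) (hp : HasDiffDegree τ.toLinearMap n p) :
    ((LieAlgebra.ad K (D.TGWAlgebra fun _ _ => 1) (D.proj _ (D.cgen _ a))) ^ (n + 1))
      (D.proj _ (D.cgen _ b)) = 0 := by
  rw [← map_ad_pow]
  refine G.proj_eq_zero (ad_pow_mem_cdeg (D.cgen_mem_cdeg _ a) (D.cgen_mem_cdeg _ b) _) ?_
  rw [map_ad_pow, G.rep_cgen, G.rep_cgen, ha, hb, ad_pow_twistedMul hcomm, hp.2]
  ext r
  simp

include G in
-- Applied to the polynomial `1`, the relation becomes `∑ c m • τ ^ m p = 0`, a polynomial in `τ` of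
-- degree at most `n` that kills `p`.
lemma Gauge.eq_zero_of_sum_eq_zero [IsDomain R] (ha : G.op a = τ.toLinearMap)
    (hb : G.op b = twistedMul p υ.toLinearMap) (hp : HasDiffDegree τ.toLinearMap n p)
    {k : ℕ} (hk : k ≤ n) (c : ℕ → K)
    (h : ∑ m ∈ Finset.range (k + 1), c m • ((D.proj (fun _ _ => 1) (D.cgen _ a)) ^ m *
      D.proj _ (D.cgen _ b) * (D.proj _ (D.cgen _ a)) ^ (k - m)) = 0) :
    ∀ m ≤ k, c m = 0 := by
  have h1 : D.proj (fun _ _ => 1) (∑ m ∈ Finset.range (k + 1), c m • ((D.cgen _ a) ^ m *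
      D.cgen _ b * (D.cgen _ a) ^ (k - m))) = 0 := by
    simpa only [map_sum, map_smul, map_mul, map_pow] using h
  have h2 := LinearMap.congr_fun (G.rep_eq_zero_of_proj_eq_zero h1) 1
  -- Automorphisms fix `1`, so the factors to the right of `p` leave no trace.
  have hone : ∀ m : ℕ, (τ.toLinearMap ^ m : Module.End K R) 1 = 1 := by
    intro m
    induction m with
    | zero => rfl
    | succ m ih => rw [pow_succ', Module.End.mul_apply, ih]; exact map_one τ
  simp only [map_sum, map_smul, map_mul, map_pow, G.rep_cgen, ha, hb, LinearMap.sum_apply,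
    LinearMap.smul_apply, Module.End.mul_apply, hone, twistedMul_apply, AlgHom.toLinearMap_apply,
    map_one, mul_one, LinearMap.zero_apply] at h2
  have hq := hp.eq_zero_of_aeval
    (q := ∑ m ∈ Finset.range (k + 1), Polynomial.C (c m) * Polynomial.X ^ m)
    (Polynomial.natDegree_sum_le_of_forall_le _ _ fun m hm =>
      (Polynomial.natDegree_C_mul_X_pow_le _ _).trans
        ((Nat.lt_succ_iff.1 (Finset.mem_range.1 hm)).trans hk))
    (by simpa [map_sum, LinearMap.sum_apply, ← Polynomial.smul_eq_C_mul] using h2)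
  intro m hm
  have h3 := congrArg (fun q => Polynomial.coeff q m) hq
  simpa [Polynomial.finsetSum_coeff, Nat.lt_succ_iff, hm] using h3

end

end TGWDatum

/-! ### Multiplicities and gauges of a multiquiver -/

namespace Multiquiver

attribute [local instance] LieRing.ofAssociativeRing

variable {V E : Type*} (Γ : Multiquiver V E)

lemma endMult_ne_zero_iff {v : V} {o : Option (V × ℕ+)} :
    endMult v o ≠ 0 ↔ ∃ n, o = some (v, n) := by
  rcases o with _ | ⟨w, n⟩
  · simp [endMult]
  · by_cases h : w = v <;> simp [endMult, h]

lemma endMult_eq_zero_or {v w : V} (h : v ≠ w) (o : Option (V × ℕ+)) :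
    endMult v o = 0 ∨ endMult w o = 0 := by
  by_contra! h2
  obtain ⟨n, h3⟩ := endMult_ne_zero_iff.1 h2.1
  obtain ⟨m, h4⟩ := endMult_ne_zero_iff.1 h2.2
  rw [h3] at h4
  simp_all

lemma endMult_s_or_t (e : E) (v : V) : endMult v (Γ.s e) = 0 ∨ endMult v (Γ.t e) = 0 := by
  by_contra! h2
  obtain ⟨n, h3⟩ := endMult_ne_zero_iff.1 h2.1
  obtain ⟨m, h4⟩ := endMult_ne_zero_iff.1 h2.2
  exact Γ.no_loops e v v n m h3 h4 rfl

lemma mem_edgesAt {e : E} {v : V} :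
    e ∈ Γ.edgesAt v ↔ endMult v (Γ.s e) ≠ 0 ∨ endMult v (Γ.t e) ≠ 0 := by
  rw [edgesAt, Set.Finite.mem_toFinset, endMult_ne_zero_iff, endMult_ne_zero_iff]
  rfl

lemma notMem_edgesAt {e : E} {v : V} :
    e ∉ Γ.edgesAt v ↔ endMult v (Γ.s e) = 0 ∧ endMult v (Γ.t e) = 0 := by
  rw [mem_edgesAt]
  tauto

lemma abs_incidence (e : E) (v : V) :
    |Γ.incidence e v| = ((endMult v (Γ.t e) + endMult v (Γ.s e) : ℕ) : ℤ) := by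
  rw [incidence]
  rcases Γ.endMult_s_or_t e v with h | h <;> simp [h]

open Classical in
/-- The total multiplicity at `j` of the edges between `i` and `j`. -/
noncomputable def mult (i j : V) : ℕ :=
  ∑ e ∈ Γ.edgesAt j, if e ∈ Γ.edgesAt i then endMult j (Γ.t e) + endMult j (Γ.s e) else 0

lemma cartan_eq_neg_mult {i j : V} (h : i ≠ j) : Γ.cartan i j = -(Γ.mult i j : ℤ) := by
  classical
  rw [cartan, if_neg h, mult, ← Finset.sum_filter, Finset.filter_mem_eq_inter, Finset.inter_comm,
    Nat.cast_sum]
  simp only [abs_incidence]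

/-- Every edge between `i` and `j` has positive multiplicity at `j`, so a zero entry means that
there is no such edge, which is symmetric in `i` and `j`. -/
lemma cartan_eq_zero_of_cartan_eq_zero {i j : V} (h : Γ.cartan i j = 0) : Γ.cartan j i = 0 := by
  classical
  by_cases hij : i = j
  · subst hij
    exact h
  · have h0 : ∀ e ∈ Γ.edgesAt i ∩ Γ.edgesAt j, False := by
      rw [cartan, if_neg hij, neg_eq_zero, Finset.sum_eq_zero_iff_of_nonneg
        (fun _ _ => abs_nonneg _)] at h
      intro e he
      have h1 := h e he
      rw [abs_incidence] at h1
      have h2 := Γ.mem_edgesAt.1 (Finset.mem_inter.1 he).2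
      omega
    rw [cartan, if_neg (Ne.symm hij), neg_eq_zero]
    exact Finset.sum_eq_zero fun e he => (h0 e (by rwa [Finset.inter_comm])).elim

section Representation

variable (K : Type*) [Field K]

lemma sigma_X (v : V) (e : E) : Γ.sigma K v (MvPolynomial.X e) =
    MvPolynomial.X e + (endMult v (Γ.s e) : MvPolynomial E K) - (endMult v (Γ.t e) : MvPolynomial E K) := by
  simp [sigma, incidence]
  ring

lemma sigma_symm_X (v : V) (e : E) : (Γ.sigma K v).symm (MvPolynomial.X e) =
    MvPolynomial.X e + (endMult v (Γ.t e) : MvPolynomial E K) - (endMult v (Γ.s e) : MvPolynomial E K) := by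
  rw [AlgEquiv.symm_apply_eq, map_sub, map_add, sigma_X, map_natCast, map_natCast]
  ring

lemma uFactor_eq (e : E) (v : V) : Γ.uFactor K e v =
    risingProd (MvPolynomial.X e) (endMult v (Γ.t e)) *
      fallingProd (MvPolynomial.X e) (endMult v (Γ.s e)) := by
  simp [uFactor, risingProd, fallingProd]

variable (B : Set E)

open Classical in
/-- The factor at the edge `e` of the coefficient by which `X v` acts. The set `B` consists of
the edges whose source end acts by a shift; for the other edges the target end does. -/
noncomputable def gaugeXFactor (e : E) (v : V) : MvPolynomial E K :=
  if e ∈ B then fallingProd (MvPolynomial.X e) (endMult v (Γ.t e))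
  else risingProd (MvPolynomial.X e) (endMult v (Γ.s e))

open Classical in
/-- The factor at the edge `e` of the coefficient by which `Y v` acts. -/
noncomputable def gaugeYFactor (e : E) (v : V) : MvPolynomial E K :=
  if e ∈ B then fallingProd (MvPolynomial.X e) (endMult v (Γ.s e))
  else risingProd (MvPolynomial.X e) (endMult v (Γ.t e))

variable {B} in
lemma gaugeXFactor_eq_one {e : E} {v : V} (h : e ∉ Γ.edgesAt v) : Γ.gaugeXFactor K B e v = 1 := by
  simp [gaugeXFactor, Γ.notMem_edgesAt.1 h]

variable {B} in
lemma gaugeYFactor_eq_one {e : E} {v : V} (h : e ∉ Γ.edgesAt v) : Γ.gaugeYFactor K B e v = 1 := by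
  simp [gaugeYFactor, Γ.notMem_edgesAt.1 h]

lemma gaugeFactor_Y_X (e : E) (v : V) :
    Γ.gaugeYFactor K B e v * (Γ.sigma K v).symm (Γ.gaugeXFactor K B e v) = Γ.uFactor K e v := by
  rw [uFactor_eq, gaugeXFactor, gaugeYFactor]
  split_ifs with h
  · rw [map_fallingProd, sigma_symm_X]
    rcases Γ.endMult_s_or_t e v with h | h
    · simp [h, fallingProd_add_self]
    · simp [h]
  · rw [map_risingProd, sigma_symm_X]
    rcases Γ.endMult_s_or_t e v with h | h
    · simp [h]
    · simp [h, risingProd_sub]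

/-- The only case with content is an edge joining `v` and `w` on which both coefficients may be
nontrivial. Then both sides split the same rising or falling product, of length the sum of the two
multiplicities, in the two possible orders. Otherwise a factor is `1` or is fixed by the shift. -/
lemma gaugeFactor_X_Y (e : E) {v w : V} (hvw : v ≠ w) :
    Γ.gaugeXFactor K B e v * Γ.sigma K v (Γ.gaugeYFactor K B e w) =
      Γ.gaugeYFactor K B e w * (Γ.sigma K w).symm (Γ.gaugeXFactor K B e v) := by
  have h1 := Γ.endMult_s_or_t e v
  have h2 := Γ.endMult_s_or_t e w
  have h3 := endMult_eq_zero_or hvw (Γ.s e)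
  have h4 := endMult_eq_zero_or hvw (Γ.t e)
  rw [gaugeXFactor, gaugeYFactor]
  split_ifs with h
  · rw [map_fallingProd, map_fallingProd, sigma_symm_X, sigma_X]
    by_cases hs : endMult w (Γ.s e) = 0
    · rcases h4 with h4 | h4 <;> simp [hs, h4]
    · have hs' := h3.resolve_right hs
      have ht' := h2.resolve_left hs
      simp only [hs', ht', Nat.cast_zero, add_zero]
      rw [← fallingProd_add, ← fallingProd_add, add_comm]
  · rw [map_risingProd, map_risingProd, sigma_symm_X, sigma_X]
    by_cases ht : endMult w (Γ.t e) = 0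
    · rcases h3 with h3 | h3 <;> simp [ht, h3]
    · have ht' := h4.resolve_right ht
      have hs' := h2.resolve_right ht
      simp only [hs', ht', Nat.cast_zero, sub_zero]
      rw [← risingProd_add, ← risingProd_add, add_comm]

/-- The action of the construction on the polynomial algebra where every edge in `B` acts by a
shift at its source and every other edge acts by a shift at its target. -/
noncomputable def gauge : (Γ.datum K).Gauge where
  g v := ∏ e ∈ Γ.edgesAt v, Γ.gaugeXFactor K B e v
  h v := ∏ e ∈ Γ.edgesAt v, Γ.gaugeYFactor K B e v
  Y_X v := by
    change _ * (Γ.sigma K v).symm _ = Γ.tElem K v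
    rw [map_prod, ← Finset.prod_mul_distrib]
    exact Finset.prod_congr rfl fun e _ => Γ.gaugeFactor_Y_X K B e v
  X_Y v w hvw := by
    classical
    change _ * Γ.sigma K v _ = _ * (Γ.sigma K w).symm _
    have hX : ∏ e ∈ Γ.edgesAt v, Γ.gaugeXFactor K B e v =
        ∏ e ∈ Γ.edgesAt v ∪ Γ.edgesAt w, Γ.gaugeXFactor K B e v :=
      Finset.prod_subset Finset.subset_union_left fun e _ h => Γ.gaugeXFactor_eq_one K h
    have hY : ∏ e ∈ Γ.edgesAt w, Γ.gaugeYFactor K B e w =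
        ∏ e ∈ Γ.edgesAt v ∪ Γ.edgesAt w, Γ.gaugeYFactor K B e w :=
      Finset.prod_subset Finset.subset_union_right fun e _ h => Γ.gaugeYFactor_eq_one K h
    rw [hX, hY, map_prod, map_prod, ← Finset.prod_mul_distrib, ← Finset.prod_mul_distrib]
    exact Finset.prod_congr rfl fun e _ => Γ.gaugeFactor_X_Y K B e hvw

variable {K}

lemma X_add_C_ne_zero (e : E) (k : K) :
    (MvPolynomial.X e + MvPolynomial.C k : MvPolynomial E K) ≠ 0 := by
  intro h
  have h2 := congrArg (MvPolynomial.eval fun _ => 1 - k) h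
  simp at h2

lemma risingProd_X_ne_zero (e : E) (n : ℕ) :
    risingProd (MvPolynomial.X e : MvPolynomial E K) n ≠ 0 := by
  refine Finset.prod_ne_zero_iff.2 fun k _ => ?_
  rw [← map_natCast MvPolynomial.C]
  exact X_add_C_ne_zero e _

lemma fallingProd_X_ne_zero (e : E) (n : ℕ) :
    fallingProd (MvPolynomial.X e : MvPolynomial E K) n ≠ 0 := by
  refine Finset.prod_ne_zero_iff.2 fun k _ => ?_
  rw [← Nat.cast_succ, ← map_natCast MvPolynomial.C, sub_eq_add_neg, ← map_neg]
  exact X_add_C_ne_zero e _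

variable [CharZero K]

/-- Factors on edges at `i` are products of linear terms that `τ` translates by `b e ≠ 0`, and each
linear term adds one to the degree. Factors on other edges are invariant and add nothing. -/
lemma hasDiffDegree_prod_edgesAt {τ : MvPolynomial E K →ₐ[K] MvPolynomial E K}
    (hinj : Function.Injective τ) {b : E → K}
    (hτ : ∀ e, τ (MvPolynomial.X e) = MvPolynomial.X e + MvPolynomial.C (b e)) {i j : V}
    (hb : ∀ e, b e = 0 ↔ e ∉ Γ.edgesAt i) {f : E → MvPolynomial E K}
    (hf : ∀ e, ∃ n, (f e = risingProd (MvPolynomial.X e) n ∨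
      f e = fallingProd (MvPolynomial.X e) n) ∧
      (e ∈ Γ.edgesAt i → e ∈ Γ.edgesAt j → n = endMult j (Γ.t e) + endMult j (Γ.s e))) :
    HasDiffDegree τ.toLinearMap (Γ.mult i j) (∏ e ∈ Γ.edgesAt j, f e) := by
  classical
  refine hasDiffDegree_prod _ fun e he n p hp => ?_
  obtain ⟨m, hm, hmn⟩ := hf e
  by_cases hei : e ∈ Γ.edgesAt i
  · have hbe : b e ≠ 0 := fun h => (hb e).1 h hei
    rw [if_pos hei, ← hmn hei he, ← Finset.card_range m]
    rcases hm with hm | hm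
    · rw [hm, Finset.card_range]
      -- The degree `m` is written as the number of linear factors, in the form required by
      -- `HasDiffDegree.mul_prod`.
      conv => arg 2; rw [← Finset.card_range m]
      refine hp.mul_prod hinj hbe _ fun k _ => ?_
      rw [map_add, map_natCast, hτ, MvPolynomial.algebraMap_eq]
      ring
    · rw [hm, Finset.card_range]
      conv => arg 2; rw [← Finset.card_range m]
      refine hp.mul_prod hinj hbe _ fun k _ => ?_
      rw [map_sub, map_add, map_one, map_natCast, hτ, MvPolynomial.algebraMap_eq]
      ring
  · rw [if_neg hei, zero_add]
    have hX : τ (MvPolynomial.X e) = MvPolynomial.X e := by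
      rw [hτ, (hb e).2 hei, map_zero, add_zero]
    rcases hm with hm | hm
    · rw [hm]
      exact hp.mul_invariant (risingProd_X_ne_zero e m) (by rw [map_risingProd, hX])
    · rw [hm]
      exact hp.mul_invariant (fallingProd_X_ne_zero e m) (by rw [map_fallingProd, hX])

lemma incidence_cast_eq_zero_iff (e : E) (i : V) :
    ((endMult i (Γ.s e) : K) - endMult i (Γ.t e)) = 0 ↔ e ∉ Γ.edgesAt i := by
  rw [notMem_edgesAt, sub_eq_zero, Nat.cast_inj]
  have := Γ.endMult_s_or_t e i
  omega

omit [CharZero K] in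
-- With `B` the set of edges with source `i`, an edge at `i` acts by a pure shift at its end `i`,
-- whichever end that is. All factors of the coefficient of `X i` are thus `1`.
lemma gauge_op_X (i : V) : (Γ.gauge K {e | endMult i (Γ.s e) ≠ 0}).op (.X i) =
    (Γ.sigma K i : MvPolynomial E K →ₐ[K] MvPolynomial E K).toLinearMap := by
  classical
  have h : (Γ.gauge K {e | endMult i (Γ.s e) ≠ 0}).g i = 1 := by
    refine Finset.prod_eq_one fun e _ => ?_
    rw [gaugeXFactor]
    split_ifs with h
    · simp [(Γ.endMult_s_or_t e i).resolve_left h]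
    · simp only [Set.mem_ofPred_eq, not_not] at h
      simp [h]
  refine LinearMap.ext fun r => ?_
  change (Γ.gauge K _).g i * (Γ.sigma K i) r = (Γ.sigma K i) r
  rw [h, one_mul]

omit [CharZero K] in
lemma gauge_op_Y (i : V) : (Γ.gauge K {e | endMult i (Γ.t e) ≠ 0}).op (.Y i) =
    ((Γ.sigma K i).symm : MvPolynomial E K →ₐ[K] MvPolynomial E K).toLinearMap := by
  classical
  have h : (Γ.gauge K {e | endMult i (Γ.t e) ≠ 0}).h i = 1 := by
    refine Finset.prod_eq_one fun e _ => ?_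
    rw [gaugeYFactor]
    split_ifs with h
    · simp [(Γ.endMult_s_or_t e i).resolve_right h]
    · simp only [Set.mem_ofPred_eq, not_not] at h
      simp [h]
  refine LinearMap.ext fun r => ?_
  change (Γ.gauge K _).h i * (Γ.sigma K i).symm r = (Γ.sigma K i).symm r
  rw [h, one_mul]

/-- On an edge joining `i` and `j` the coefficient sits entirely at `j`, with length the full
multiplicity there, since the end at `i` acts by a shift. -/
lemma hasDiffDegree_gauge_g {i j : V} (hij : i ≠ j) :
    HasDiffDegree (Γ.sigma K i : MvPolynomial E K →ₐ[K] MvPolynomial E K).toLinearMap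
      (Γ.mult i j) ((Γ.gauge K {e | endMult i (Γ.s e) ≠ 0}).g j) := by
  classical
  refine Γ.hasDiffDegree_prod_edgesAt (Γ.sigma K i).injective
    (b := fun e => endMult i (Γ.s e) - endMult i (Γ.t e)) (fun e => ?_)
    (fun e => Γ.incidence_cast_eq_zero_iff e i) (fun e => ?_)
  · change Γ.sigma K i _ = _
    rw [sigma_X, map_sub, map_natCast, map_natCast]
    ring
  · have h3 := endMult_eq_zero_or hij (Γ.s e)
    have h4 := endMult_eq_zero_or hij (Γ.t e)
    simp only [mem_edgesAt]
    rw [gaugeXFactor]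
    split_ifs with h
    · refine ⟨_, .inr rfl, fun _ _ => ?_⟩
      rw [Set.mem_ofPred_eq] at h
      omega
    · refine ⟨_, .inl rfl, fun _ _ => ?_⟩
      rw [Set.mem_ofPred_eq] at h
      omega

lemma hasDiffDegree_gauge_h {i j : V} (hij : i ≠ j) :
    HasDiffDegree ((Γ.sigma K i).symm : MvPolynomial E K →ₐ[K] MvPolynomial E K).toLinearMap
      (Γ.mult i j) ((Γ.gauge K {e | endMult i (Γ.t e) ≠ 0}).h j) := by
  classical
  refine Γ.hasDiffDegree_prod_edgesAt (Γ.sigma K i).symm.injective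
    (b := fun e => -(endMult i (Γ.s e) - endMult i (Γ.t e))) (fun e => ?_)
    (fun e => by rw [neg_eq_zero, Γ.incidence_cast_eq_zero_iff e i]) (fun e => ?_)
  · change (Γ.sigma K i).symm _ = _
    rw [sigma_symm_X, map_neg, map_sub, map_natCast, map_natCast]
    ring
  · have h3 := endMult_eq_zero_or hij (Γ.s e)
    have h4 := endMult_eq_zero_or hij (Γ.t e)
    simp only [mem_edgesAt]
    rw [gaugeYFactor]
    split_ifs with h
    · refine ⟨_, .inr rfl, fun _ _ => ?_⟩
      rw [Set.mem_ofPred_eq] at h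
      omega
    · refine ⟨_, .inl rfl, fun _ _ => ?_⟩
      rw [Set.mem_ofPred_eq] at h
      omega

omit [CharZero K] in
lemma sigma_symm_comm (i j : V) (r : MvPolynomial E K) :
    (Γ.sigma K i).symm ((Γ.sigma K j).symm r) = (Γ.sigma K j).symm ((Γ.sigma K i).symm r) := by
  rw [AlgEquiv.symm_apply_eq, AlgEquiv.symm_apply_eq]
  have h := (Γ.datum K).σ_comm i j ((Γ.sigma K j).symm ((Γ.sigma K i).symm r))
  change Γ.sigma K i (Γ.sigma K j _) = Γ.sigma K j (Γ.sigma K i _) at h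
  rw [← h]
  simp

omit [CharZero K] in
lemma toNat_one_sub_cartan {i j : V} (hij : i ≠ j) :
    (1 - Γ.cartan i j).toNat = Γ.mult i j + 1 := by
  rw [Γ.cartan_eq_neg_mult hij]
  omega

/-- The Serre relations for the generators `X i` of the algebra of a multiquiver. -/
theorem serre_X {i j : V} (hij : i ≠ j) :
    ((LieAlgebra.ad K (Γ.Alg K) (Γ.X K i)) ^ (1 - Γ.cartan i j).toNat) (Γ.X K j) = 0 := by
  rw [Γ.toNat_one_sub_cartan hij]
  exact (Γ.gauge K _).serre (Γ.gauge_op_X i) (υ := (Γ.sigma K j : MvPolynomial E K →ₐ[K] MvPolynomial E K)) rfl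
    ((Γ.datum K).σ_comm i j) (Γ.hasDiffDegree_gauge_g hij)

/-- The Serre relations for the generators `Y i` of the algebra of a multiquiver. -/
theorem serre_Y {i j : V} (hij : i ≠ j) :
    ((LieAlgebra.ad K (Γ.Alg K) (Γ.Y K i)) ^ (1 - Γ.cartan i j).toNat) (Γ.Y K j) = 0 := by
  rw [Γ.toNat_one_sub_cartan hij]
  exact (Γ.gauge K _).serre (Γ.gauge_op_Y i)
    (υ := ((Γ.sigma K j).symm : MvPolynomial E K →ₐ[K] MvPolynomial E K)) rfl
    (Γ.sigma_symm_comm i j) (Γ.hasDiffDegree_gauge_h hij)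

theorem X_words_indep {i j : V} (hij : i ≠ j) {k : ℕ} (hk : (k : ℤ) ≤ -Γ.cartan i j) (c : ℕ → K)
    (h : ∑ m ∈ Finset.range (k + 1), c m • (Γ.X K i ^ m * Γ.X K j * Γ.X K i ^ (k - m)) = 0) :
    ∀ m ≤ k, c m = 0 := by
  exact (Γ.gauge K _).eq_zero_of_sum_eq_zero (Γ.gauge_op_X i)
    (υ := (Γ.sigma K j : MvPolynomial E K →ₐ[K] MvPolynomial E K)) rfl
    (Γ.hasDiffDegree_gauge_g hij) (by rw [Γ.cartan_eq_neg_mult hij] at hk; omega) c h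

theorem Y_words_indep {i j : V} (hij : i ≠ j) {k : ℕ} (hk : (k : ℤ) ≤ -Γ.cartan i j) (c : ℕ → K)
    (h : ∑ m ∈ Finset.range (k + 1), c m • (Γ.Y K i ^ m * Γ.Y K j * Γ.Y K i ^ (k - m)) = 0) :
    ∀ m ≤ k, c m = 0 := by
  exact (Γ.gauge K _).eq_zero_of_sum_eq_zero (Γ.gauge_op_Y i)
    (υ := ((Γ.sigma K j).symm : MvPolynomial E K →ₐ[K] MvPolynomial E K)) rfl
    (Γ.hasDiffDegree_gauge_h hij) (by rw [Γ.cartan_eq_neg_mult hij] at hk; omega) c h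

end Representation

end Multiquiver

/-! ### Serre elements and opposite Chevalley generators -/

section LieAlgebraLemmas

variable {K L L' : Type*} [Field K] [LieRing L] [LieAlgebra K L] [LieRing L'] [LieAlgebra K L']

lemma LieHom.map_ad_pow (φ : L →ₗ⁅K⁆ L') (x y : L) (n : ℕ) :
    φ (((LieAlgebra.ad K L x) ^ n) y) = ((LieAlgebra.ad K L' (φ x)) ^ n) (φ y) := by
  induction n with
  | zero => rfl
  | succ n ih => simp only [pow_succ', Module.End.mul_apply, LieAlgebra.ad_apply, LieHom.map_lie, ih]

lemma lie_ad_pow_eigen {h e v : L} {a b : K} (he : ⁅h, e⁆ = a • e) (hv : ⁅h, v⁆ = b • v) (n : ℕ) :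
    ⁅h, ((LieAlgebra.ad K L e) ^ n) v⁆ = (b + n * a) • ((LieAlgebra.ad K L e) ^ n) v := by
  induction n with
  | zero => simpa using hv
  | succ n ih =>
    rw [pow_succ', Module.End.mul_apply, LieAlgebra.ad_apply, leibniz_lie, ih, he, smul_lie,
      lie_smul, ← add_smul]
    push_cast
    congr 1
    ring

lemma lie_ad_pow_of_lie_eq_zero {e f v : L} (hfe : ⁅f, e⁆ = 0) (n : ℕ) :
    ⁅f, ((LieAlgebra.ad K L e) ^ n) v⁆ = ((LieAlgebra.ad K L e) ^ n) ⁅f, v⁆ := by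
  induction n with
  | zero => rfl
  | succ n ih =>
    rw [pow_succ', Module.End.mul_apply, LieAlgebra.ad_apply, leibniz_lie, ih, hfe, zero_lie,
      zero_add, Module.End.mul_apply, LieAlgebra.ad_apply]

/-- The `sl₂` computation on a lowest weight vector: the scalar is minus the sum of the weights `c +
2 m` for `0 ≤ m ≤ n`. -/
lemma lie_ad_pow_succ_of_sl2 {h e f v : L} {c : K} (hef : ⁅e, f⁆ = h) (he : ⁅h, e⁆ = (2 : K) • e)
    (hfv : ⁅f, v⁆ = 0) (hv : ⁅h, v⁆ = c • v) (n : ℕ) :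
    ⁅f, ((LieAlgebra.ad K L e) ^ (n + 1)) v⁆ =
      (-((n + 1 : K) * (c + n))) • ((LieAlgebra.ad K L e) ^ n) v := by
  have hfe : ⁅f, e⁆ = -h := by rw [← lie_skew, hef]
  induction n with
  | zero =>
    rw [zero_add, pow_one, LieAlgebra.ad_apply, leibniz_lie, hfv, lie_zero, hfe, neg_lie, hv]
    simp
  | succ n ih =>
    rw [pow_succ', Module.End.mul_apply, LieAlgebra.ad_apply, leibniz_lie, ih, hfe, neg_lie,
      lie_ad_pow_eigen he hv, lie_smul, ← neg_smul, pow_succ', Module.End.mul_apply,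
      LieAlgebra.ad_apply, ← add_smul]
    push_cast
    congr 1
    ring

/-- In a Lie algebra with Chevalley generators, the elements `f k` commute with the Serre elements
of the `e i`. -/
lemma lie_serre_eq_zero {V : Type*} {a : V → V → ℤ} (hdiag : ∀ i, a i i = 2)
    (hnonpos : ∀ i j, i ≠ j → a i j ≤ 0) (hzero : ∀ i j, a i j = 0 → a j i = 0) {e f h : V → L}
    (hef : ∀ i, ⁅e i, f i⁆ = h i) (hne : ∀ i j, i ≠ j → ⁅e i, f j⁆ = 0)
    (hhe : ∀ i j, ⁅h i, e j⁆ = (a i j : K) • e j) {i j : V} (hij : i ≠ j) (k : V) :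
    ⁅f k, ((LieAlgebra.ad K L (e i)) ^ (1 - a i j).toNat) (e j)⁆ = 0 := by
  obtain ⟨n, hn⟩ : ∃ n : ℕ, a i j = -n := ⟨(-a i j).toNat, by have := hnonpos i j hij; omega⟩
  have hN : (1 - a i j).toNat = n + 1 := by omega
  have hfe : ∀ i k, i ≠ k → ⁅f k, e i⁆ = 0 := fun i k h => by rw [← lie_skew, hne i k h, neg_zero]
  rw [hN]
  by_cases hki : i = k
  · subst hki
    -- Here the scalar contains the factor `c + n = a i j + n = 0`.
    rw [lie_ad_pow_succ_of_sl2 (c := (a i j : K)) (hef i)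
      (by rw [hhe, hdiag, Int.cast_ofNat]) (hfe j i (Ne.symm hij)) (hhe i j), hn]
    simp
  · rw [lie_ad_pow_of_lie_eq_zero (hfe i k hki)]
    by_cases hkj : j = k
    · subst hkj
      have h1 : ⁅e i, ⁅f j, e j⁆⁆ = (a j i : K) • e i := by
        rw [← lie_skew (f j), hef, lie_neg, lie_skew, hhe]
      rw [pow_succ, Module.End.mul_apply, LieAlgebra.ad_apply, h1, map_smul]
      -- If `n` is positive, a further `ad (e i)` kills `e i`. If `n` is zero there is none left,
      -- and `a i j = 0` forces the scalar `a j i` to vanish.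
      cases n with
      | zero => rw [hzero i j (by simpa using hn), Int.cast_zero, zero_smul]
      | succ n =>
        rw [pow_succ, Module.End.mul_apply, LieAlgebra.ad_apply, lie_self, map_zero, smul_zero]
    · rw [hfe j k hkj, map_zero]

end LieAlgebraLemmas

attribute [local instance] LieRing.ofAssociativeRing

/-- Iterated commutators descend along an intertwining map, so Serre relations can be computed
before passing to the quotient. -/
lemma ad_pow_intertwine {K T M : Type*} [Field K] [AddCommGroup T] [Module K T] [AddCommGroup M]
    [Module K M] {π : T →ₗ[K] M} {x y : Module.End K T} {x' y' : Module.End K M}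
    (hx : ∀ m, x' (π m) = π (x m)) (hy : ∀ m, y' (π m) = π (y m)) (n : ℕ) (m : T) :
    ((LieAlgebra.ad K (Module.End K M) x') ^ n) y' (π m) =
      π (((LieAlgebra.ad K (Module.End K T) x) ^ n) y m) := by
  induction n generalizing m with
  | zero => exact hy m
  | succ n ih =>
    simp only [pow_succ', Module.End.mul_apply, LieAlgebra.ad_apply,
      LieRing.of_associative_ring_bracket, LinearMap.sub_apply, map_sub, ih, hx]

section AssociativeAlgebra

variable {K A : Type*} [Field K] [Ring A] [Algebra K A]

lemma commutator_ad_pow_eigen {h e v : A} {a b : K} (he : h * e - e * h = a • e)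
    (hv : h * v - v * h = b • v) (n : ℕ) :
    h * ((LieAlgebra.ad K A e) ^ n) v =
      ((LieAlgebra.ad K A e) ^ n) v * h + (b + n * a) • ((LieAlgebra.ad K A e) ^ n) v := by
  rw [← sub_eq_iff_eq_add']
  exact lie_ad_pow_eigen (K := K) (h := h) he hv n

lemma commute_serre {V : Type*} {a : V → V → ℤ} (hdiag : ∀ i, a i i = 2)
    (hnonpos : ∀ i j, i ≠ j → a i j ≤ 0) (hzero : ∀ i j, a i j = 0 → a j i = 0) {e f h : V → A}
    (hef : ∀ i, e i * f i - f i * e i = h i) (hne : ∀ i j, i ≠ j → e i * f j - f j * e i = 0)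
    (hhe : ∀ i j, h i * e j - e j * h i = (a i j : K) • e j) {i j : V} (hij : i ≠ j) (k : V) :
    f k * ((LieAlgebra.ad K A (e i)) ^ (1 - a i j).toNat) (e j) =
      ((LieAlgebra.ad K A (e i)) ^ (1 - a i j).toNat) (e j) * f k := by
  rw [← sub_eq_zero]
  exact lie_serre_eq_zero hdiag hnonpos hzero hef hne hhe hij k

end AssociativeAlgebra

/-! ### The lowest weight Verma module on words -/

namespace Realization

variable {K : Type*} [Field K] {V : Type*} {A : V → V → ℤ} {𝔥 : Type*} [AddCommGroup 𝔥]
  [Module K 𝔥] (ρ : Realization K A 𝔥)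

section Verma

variable (K) in
/-- The left multiplication by a generator on the free module on words. -/
noncomputable def wordE (i : V) : Module.End K (List V →₀ K) := Finsupp.lmapDomain K K (List.cons i)

@[simp] lemma wordE_single (i : V) (w : List V) (c : K) :
    wordE K i (Finsupp.single w c) = Finsupp.single (i :: w) c := by simp [wordE]

/-- The weight of a word. -/
def wordWeight (w : List V) : Module.Dual K 𝔥 := (w.map ρ.root).sum

/-- The action of `𝔥` on the free module on words. -/
noncomputable def wordH (x : 𝔥) : Module.End K (List V →₀ K) :=
  Finsupp.linearCombination K fun w => ρ.wordWeight w x • Finsupp.single w (1 : K)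

@[simp] lemma wordH_single (x : 𝔥) (w : List V) :
    ρ.wordH x (Finsupp.single w 1) = ρ.wordWeight w x • Finsupp.single w (1 : K) := by
  simp [wordH]

open Classical in
/-- The value on a word of the action of `f i` on the lowest weight Verma module of weight zero. -/
noncomputable def wordFAux (i : V) : List V → (List V →₀ K)
  | [] => 0
  | j :: w => wordE K j (wordFAux i w) -
      if i = j then ρ.wordH (ρ.coroot i) (Finsupp.single w 1) else 0

/-- The action of `f i` on the lowest weight Verma module of weight zero. -/
noncomputable def wordF (i : V) : Module.End K (List V →₀ K) :=
  Finsupp.linearCombination K (ρ.wordFAux i)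

@[simp] lemma wordF_single (i : V) (w : List V) :
    ρ.wordF i (Finsupp.single w 1) = ρ.wordFAux i w := by
  simp [wordF]

lemma end_word_ext {M : Type*} [AddCommGroup M] [Module K M] {φ ψ : (List V →₀ K) →ₗ[K] M}
    (h : ∀ w, φ (Finsupp.single w 1) = ψ (Finsupp.single w 1)) : φ = ψ :=
  Finsupp.lhom_ext' fun w => LinearMap.ext_ring (h w)

lemma wordWeight_cons (i : V) (w : List V) (x : 𝔥) :
    ρ.wordWeight (i :: w) x = ρ.root i x + ρ.wordWeight w x := by simp [wordWeight]

lemma wordH_lie_wordH (x y : 𝔥) : ρ.wordH x * ρ.wordH y - ρ.wordH y * ρ.wordH x = 0 := by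
  refine end_word_ext fun w => ?_
  simp only [LinearMap.sub_apply, Module.End.mul_apply, wordH_single, map_smul, smul_smul, mul_comm,
    sub_self, LinearMap.zero_apply]

lemma wordH_lie_wordE (x : 𝔥) (i : V) : ρ.wordH x * wordE K i - wordE K i * ρ.wordH x = ρ.root i x • wordE K i := by
  refine end_word_ext fun w => ?_
  simp only [LinearMap.sub_apply, Module.End.mul_apply, wordE_single, wordH_single, map_smul,
    wordWeight_cons, LinearMap.smul_apply]
  module

lemma wordE_lie_wordF (i : V) : wordE K i * ρ.wordF i - ρ.wordF i * wordE K i = ρ.wordH (ρ.coroot i) := by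
  refine end_word_ext fun w => ?_
  simp [wordFAux]

lemma wordE_lie_wordF_of_ne {i j : V} (hij : i ≠ j) : wordE K i * ρ.wordF j - ρ.wordF j * wordE K i = 0 := by
  refine end_word_ext fun w => ?_
  simp [wordFAux, Ne.symm hij]

lemma wordH_lie_wordF (x : 𝔥) (i : V) : ρ.wordH x * ρ.wordF i - ρ.wordF i * ρ.wordH x = (-ρ.root i x) • ρ.wordF i := by
  refine end_word_ext fun w => ?_
  suffices h : ρ.wordH x (ρ.wordFAux i w) = (ρ.wordWeight w x - ρ.root i x) • ρ.wordFAux i w by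
    simp only [LinearMap.sub_apply, Module.End.mul_apply, wordF_single, wordH_single, map_smul,
      LinearMap.smul_apply, h]
    module
  induction w with
  | nil => simp [wordFAux]
  | cons j w ih =>
    have hE : ρ.wordH x (wordE K j (ρ.wordFAux i w)) =
        wordE K j (ρ.wordH x (ρ.wordFAux i w)) + ρ.root j x • wordE K j (ρ.wordFAux i w) := by
      have h := LinearMap.congr_fun (ρ.wordH_lie_wordE x j) (ρ.wordFAux i w)
      rw [LinearMap.sub_apply, sub_eq_iff_eq_add'] at h
      exact h
    rw [wordFAux, map_sub, hE, ih, wordWeight_cons, map_smul]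
    split_ifs with hij
    · subst hij
      simp only [wordH_single, map_smul]
      module
    · rw [map_zero]
      module

variable (hdiag : ∀ i, A i i = 2) (hnonpos : ∀ i j, i ≠ j → A i j ≤ 0)
  (hzero : ∀ i j, A i j = 0 → A j i = 0)

variable (K A) in
/-- The Serre element of the operators `wordE`. -/
noncomputable def wordSerre (i j : V) : Module.End K (List V →₀ K) :=
  ((LieAlgebra.ad K (Module.End K (List V →₀ K)) (wordE K i)) ^ (1 - A i j).toNat) (wordE K j)

include hdiag hnonpos hzero in
lemma wordF_lie_wordSerre {i j : V} (hij : i ≠ j) (k : V) :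
    ρ.wordF k * wordSerre K A i j = wordSerre K A i j * ρ.wordF k :=
  commute_serre (h := fun i => ρ.wordH (ρ.coroot i)) hdiag hnonpos hzero ρ.wordE_lie_wordF
    (fun _ _ => ρ.wordE_lie_wordF_of_ne)
    (fun i j => by rw [wordH_lie_wordE, ρ.pairing]) hij k

include hdiag hnonpos hzero in
/-- The operators `wordF` satisfy the Serre relations. -/
lemma wordF_serre {i j : V} (hij : i ≠ j) :
    ((LieAlgebra.ad K (Module.End K (List V →₀ K)) (ρ.wordF i)) ^ (1 - A i j).toNat)
      (ρ.wordF j) = 0 := by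
  -- The roles of `e` and `f` are exchanged and `h` changes sign. The Serre element of the `f` thus
  -- commutes with every `wordE k`.
  have hcomm := fun k => commute_serre (K := K) (e := ρ.wordF) (f := wordE K)
    (h := fun i => -ρ.wordH (ρ.coroot i)) hdiag hnonpos hzero
    (fun i => (neg_sub (_ : Module.End K (List V →₀ K)) _).symm.trans
      (congrArg Neg.neg (ρ.wordE_lie_wordF i)))
    (fun i j hij => by
      refine LinearMap.ext fun m => ?_
      have h := LinearMap.congr_fun (ρ.wordE_lie_wordF_of_ne (Ne.symm hij)) m
      simp only [LinearMap.sub_apply, Module.End.mul_apply, LinearMap.zero_apply,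
        sub_eq_zero] at h ⊢
      exact h.symm)
    (fun i j => by
      refine LinearMap.ext fun m => ?_
      have h := LinearMap.congr_fun (ρ.wordH_lie_wordF (ρ.coroot i) j) m
      simp only [LinearMap.sub_apply, Module.End.mul_apply, LinearMap.smul_apply, ρ.pairing,
        LinearMap.neg_apply, map_neg, neg_smul] at h ⊢
      rw [← neg_sub', h, neg_neg]) hij k
  -- The `f` kill the vacuum, hence so do their iterated commutators. Every word is obtained from
  -- the vacuum by operators `wordE k`, with which the Serre element commutes, so the relation holds
  -- already before passing to the quotient.
  have hnil : ∀ n, ((LieAlgebra.ad K (Module.End K (List V →₀ K)) (ρ.wordF i)) ^ n)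
      (ρ.wordF j) (Finsupp.single [] 1) = 0 := by
    intro n
    induction n with
    | zero => simp [wordFAux]
    | succ n ih =>
      rw [pow_succ', Module.End.mul_apply, LieAlgebra.ad_apply,
        LieRing.of_associative_ring_bracket, LinearMap.sub_apply, Module.End.mul_apply, ih,
        Module.End.mul_apply, wordF_single]
      simp [wordFAux]
  refine end_word_ext fun w => ?_
  rw [LinearMap.zero_apply]
  induction w with
  | nil => exact hnil _
  | cons k w ih =>
    have h := LinearMap.congr_fun (hcomm k) (Finsupp.single w 1)
    rw [Module.End.mul_apply, ih, map_zero, Module.End.mul_apply, wordE_single] at h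
    exact h.symm

variable (K A) in
/-- The submodule of the free module on words that corresponds to the two-sided ideal generated by
the Serre elements. -/
noncomputable def serreSubmodule : Submodule K (List V →₀ K) :=
  Submodule.span K {x | ∃ (w : List V) (i j : V) (m : List V →₀ K), i ≠ j ∧
    x = (w.map (wordE K)).prod (wordSerre K A i j m)}

lemma wordE_mem_serreSubmodule (k : V) :
    serreSubmodule K A ≤ (serreSubmodule K A).comap (wordE K k) := by
  refine Submodule.span_le.2 ?_
  rintro _ ⟨w, i, j, m, hij, rfl⟩
  exact Submodule.subset_span ⟨k :: w, i, j, m, hij, by simp⟩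

lemma wordSerre_mem_serreSubmodule {i j : V} (hij : i ≠ j) (m : List V →₀ K) :
    wordSerre K A i j m ∈ serreSubmodule K A :=
  Submodule.subset_span ⟨[], i, j, m, hij, by simp⟩

lemma wordH_mem_serreSubmodule (x : 𝔥) :
    serreSubmodule K A ≤ (serreSubmodule K A).comap (ρ.wordH x) := by
  refine Submodule.span_le.2 ?_
  rintro _ ⟨w, i, j, m, hij, rfl⟩
  change ρ.wordH x _ ∈ serreSubmodule K A
  induction w with
  | nil =>
    have h : ρ.wordH x (wordSerre K A i j m) = wordSerre K A i j (ρ.wordH x m) +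
        (ρ.root j x + (1 - A i j).toNat * ρ.root i x) • wordSerre K A i j m :=
      LinearMap.congr_fun (commutator_ad_pow_eigen (K := K) (A := Module.End K (List V →₀ K))
        (ρ.wordH_lie_wordE x i) (ρ.wordH_lie_wordE x j) (1 - A i j).toNat) m
    rw [List.map_nil, List.prod_nil, Module.End.one_apply, h]
    exact add_mem (wordSerre_mem_serreSubmodule hij _)
      (Submodule.smul_mem _ _ (wordSerre_mem_serreSubmodule hij _))
  | cons k w ih =>
    have h := LinearMap.congr_fun (ρ.wordH_lie_wordE x k)
      ((w.map (wordE K)).prod (wordSerre K A i j m))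
    rw [LinearMap.sub_apply, sub_eq_iff_eq_add] at h
    rw [List.map_cons, List.prod_cons]
    refine (congrArg (· ∈ serreSubmodule K A) h).mpr (add_mem (Submodule.smul_mem _ _ ?_) ?_)
    · exact wordE_mem_serreSubmodule k (Submodule.subset_span ⟨w, i, j, m, hij, rfl⟩)
    · exact wordE_mem_serreSubmodule k ih

include hdiag hnonpos hzero in
-- `wordF k` commutes with Serre elements. Moving it past a letter costs at most an operator
-- `wordH`, which preserves the submodule.
lemma wordF_mem_serreSubmodule (k : V) :
    serreSubmodule K A ≤ (serreSubmodule K A).comap (ρ.wordF k) := by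
  classical
  refine Submodule.span_le.2 ?_
  rintro _ ⟨w, i, j, m, hij, rfl⟩
  change ρ.wordF k _ ∈ serreSubmodule K A
  induction w with
  | nil =>
    have h := LinearMap.congr_fun (ρ.wordF_lie_wordSerre hdiag hnonpos hzero hij k) m
    rw [List.map_nil, List.prod_nil, Module.End.one_apply]
    refine (congrArg (· ∈ serreSubmodule K A) h).mpr ?_
    exact wordSerre_mem_serreSubmodule hij _
  | cons l w ih =>
    have h : wordE K l * ρ.wordF k - ρ.wordF k * wordE K l = if l = k then ρ.wordH (ρ.coroot k) else 0 := by
      split_ifs with hlk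
      · rw [hlk, wordE_lie_wordF]
      · exact ρ.wordE_lie_wordF_of_ne hlk
    have h2 := LinearMap.congr_fun h ((w.map (wordE K)).prod (wordSerre K A i j m))
    rw [LinearMap.sub_apply, sub_eq_iff_eq_add',
      ← sub_eq_iff_eq_add] at h2
    rw [List.map_cons, List.prod_cons]
    refine (congrArg (· ∈ serreSubmodule K A) h2).mp (sub_mem ?_ ?_)
    · exact wordE_mem_serreSubmodule l ih
    · split_ifs
      · exact ρ.wordH_mem_serreSubmodule _ (Submodule.subset_span ⟨w, i, j, m, hij, rfl⟩)
      · exact zero_mem _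

end Verma

end Realization

/-! ### The Kac–Moody action on the Serre quotient and maps out of `n⁺` and `n⁻` -/

namespace Realization

variable {K : Type*} [Field K] {V : Type*} {A : V → V → ℤ} {𝔥 : Type*} [AddCommGroup 𝔥]
  [Module K 𝔥] (ρ : Realization K A 𝔥)

section Lift

variable {L : Type*} [LieRing L] [LieAlgebra K L]

/-- Lie algebra homomorphisms from the Kac–Moody algebra are given by maps on generators that respect
the defining relators. -/
noncomputable def lift (φ : Gen V 𝔥 → L)
    (h : ∀ x, ρ.Relator x → FreeLieAlgebra.lift K φ x = 0) : ρ.KacMoody →ₗ⁅K⁆ L :=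
  { Submodule.liftQ ρ.ideal.toSubmodule
      (FreeLieAlgebra.lift K φ : FreeLieAlgebra K (Gen V 𝔥) →ₗ[K] L) (by
        have hle : ρ.ideal ≤ (FreeLieAlgebra.lift K φ).ker :=
          LieSubmodule.lieSpan_le.2 fun x hx => LieHom.mem_ker.2 (h x hx)
        intro x hx
        exact LieHom.mem_ker.1 (hle hx)) with
    map_lie' := by
      intro x y
      obtain ⟨x, rfl⟩ := Submodule.Quotient.mk_surjective _ x
      obtain ⟨y, rfl⟩ := Submodule.Quotient.mk_surjective _ y
      exact LieHom.map_lie (FreeLieAlgebra.lift K φ) x y }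

lemma lift_gen (φ : Gen V 𝔥 → L) (h : ∀ x, ρ.Relator x → FreeLieAlgebra.lift K φ x = 0)
    (g : Gen V 𝔥) : ρ.lift φ h (ρ.gen g) = φ g :=
  FreeLieAlgebra.lift_of_apply φ g

/-- A Lie algebra homomorphism from the Kac–Moody algebra with prescribed values on generators. -/
lemma exists_lieHom (H : 𝔥 →ₗ[K] L) (e f : V → L) (hHH : ∀ x y, ⁅H x, H y⁆ = 0)
    (hef : ∀ i, ⁅e i, f i⁆ = H (ρ.coroot i)) (hne : ∀ i j, i ≠ j → ⁅e i, f j⁆ = 0)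
    (hHe : ∀ x i, ⁅H x, e i⁆ = ρ.root i x • e i) (hHf : ∀ x i, ⁅H x, f i⁆ = (-ρ.root i x) • f i)
    (hse : ∀ i j, i ≠ j → ((LieAlgebra.ad K L (e i)) ^ (1 - A i j).toNat) (e j) = 0)
    (hsf : ∀ i j, i ≠ j → ((LieAlgebra.ad K L (f i)) ^ (1 - A i j).toNat) (f j) = 0) :
    ∃ θ : ρ.KacMoody →ₗ⁅K⁆ L, (∀ i, θ (ρ.gen (.e i)) = e i) ∧ ∀ i, θ (ρ.gen (.f i)) = f i := by
  let φ : Gen V 𝔥 → L := fun g => match g with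
    | .h x => H x
    | .e i => e i
    | .f i => f i
  have hφ : ∀ g, FreeLieAlgebra.lift K φ (Gen.free K g) = φ g := FreeLieAlgebra.lift_of_apply φ
  refine ⟨ρ.lift φ ?_, fun i => ρ.lift_gen φ _ _, fun i => ρ.lift_gen φ _ _⟩
  intro x hx
  cases hx with
  | h_add x y => simp only [map_sub, map_add, hφ, φ, map_add, sub_self]
  | h_smul c x => simp only [map_sub, map_smul, hφ, φ, map_smul, sub_self]
  | h_h x y => simp only [LieHom.map_lie, hφ, φ, hHH]
  | e_f i => simp only [map_sub, LieHom.map_lie, hφ, φ, hef, sub_self]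
  | e_f_ne i j hij => simp only [LieHom.map_lie, hφ, φ, hne i j hij]
  | h_e x i => simp only [map_sub, LieHom.map_lie, map_smul, hφ, φ, hHe, sub_self]
  | h_f x i => simp only [map_sub, LieHom.map_lie, map_smul, hφ, φ, hHf, sub_self]
  | serre_e i j hij => rw [LieHom.map_ad_pow, hφ, hφ]; exact hse i j hij
  | serre_f i j hij => rw [LieHom.map_ad_pow, hφ, hφ]; exact hsf i j hij

end Lift

section QuotientVerma

variable (hdiag : ∀ i, A i i = 2) (hnonpos : ∀ i j, i ≠ j → A i j ≤ 0)
  (hzero : ∀ i j, A i j = 0 → A j i = 0)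

variable (K A) in
/-- The quotient of the free module on words by the Serre relations. -/
abbrev SerreQuotient := (List V →₀ K) ⧸ serreSubmodule K A

variable (K A) in
/-- The action of `e i` on the quotient module. -/
noncomputable def quotE (i : V) : Module.End K (SerreQuotient K A) :=
  (serreSubmodule K A).mapQ _ (wordE K i) (wordE_mem_serreSubmodule i)

/-- The action of `𝔥` on the quotient module. -/
noncomputable def quotH : 𝔥 →ₗ[K] Module.End K (SerreQuotient K A) where
  toFun x := (serreSubmodule K A).mapQ _ (ρ.wordH x) (ρ.wordH_mem_serreSubmodule x)
  map_add' x y := by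
    refine LinearMap.ext fun m => ?_
    obtain ⟨m, rfl⟩ := Submodule.Quotient.mk_surjective _ m
    have h : ρ.wordH (x + y) = ρ.wordH x + ρ.wordH y :=
      end_word_ext fun w => by simp only [wordH_single, map_add, add_smul, LinearMap.add_apply]
    simp only [Submodule.mapQ_apply, LinearMap.add_apply, h, Submodule.Quotient.mk_add]
  map_smul' c x := by
    refine LinearMap.ext fun m => ?_
    obtain ⟨m, rfl⟩ := Submodule.Quotient.mk_surjective _ m
    have h : ρ.wordH (c • x) = c • ρ.wordH x :=
      end_word_ext fun w => by
        simp only [wordH_single, map_smul, smul_smul, LinearMap.smul_apply, smul_eq_mul]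
    simp only [Submodule.mapQ_apply, LinearMap.smul_apply, h, Submodule.Quotient.mk_smul,
      RingHom.id_apply]

/-- The action of `f i` on the quotient module. -/
noncomputable def quotF (i : V) : Module.End K (SerreQuotient K A) :=
  (serreSubmodule K A).mapQ _ (ρ.wordF i) (ρ.wordF_mem_serreSubmodule hdiag hnonpos hzero i)

lemma end_quotient_ext {T : Type*} [AddCommGroup T] [Module K T] {S : Submodule K T}
    {φ ψ : Module.End K (T ⧸ S)} (h : ∀ m, φ (S.mkQ m) = ψ (S.mkQ m)) : φ = ψ := by
  refine LinearMap.ext fun m => ?_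
  obtain ⟨m, rfl⟩ := S.mkQ_surjective m
  exact h m

lemma quotE_mkQ (i : V) (m : List V →₀ K) :
    quotE K A i ((serreSubmodule K A).mkQ m) = (serreSubmodule K A).mkQ (wordE K i m) := rfl

lemma quotH_mkQ (x : 𝔥) (m : List V →₀ K) :
    ρ.quotH x ((serreSubmodule K A).mkQ m) = (serreSubmodule K A).mkQ (ρ.wordH x m) := rfl

lemma quotF_mkQ (i : V) (m : List V →₀ K) :
    ρ.quotF hdiag hnonpos hzero i ((serreSubmodule K A).mkQ m) =
      (serreSubmodule K A).mkQ (ρ.wordF i m) := rfl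

lemma commutator_mkQ {T : Type*} [AddCommGroup T] [Module K T] {S : Submodule K T}
    {x y z : Module.End K T} {x' y' z' : Module.End K (T ⧸ S)}
    (hx : ∀ m, x' (S.mkQ m) = S.mkQ (x m)) (hy : ∀ m, y' (S.mkQ m) = S.mkQ (y m))
    (hz : ∀ m, z' (S.mkQ m) = S.mkQ (z m)) (h : x * y - y * x = z) : x' * y' - y' * x' = z' := by
  refine end_quotient_ext fun m => ?_
  rw [LinearMap.sub_apply, Module.End.mul_apply, Module.End.mul_apply, hx, hy, hx, hy, hz, ← h,
    ← map_sub]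
  rfl

lemma quotH_commutator_quotH (x y : 𝔥) :
    ρ.quotH x * ρ.quotH y - ρ.quotH y * ρ.quotH x = 0 :=
  commutator_mkQ (ρ.quotH_mkQ x) (ρ.quotH_mkQ y) (fun m => by simp) (ρ.wordH_lie_wordH x y)

lemma quotE_commutator_quotF (i : V) :
    quotE K A i * ρ.quotF hdiag hnonpos hzero i - ρ.quotF hdiag hnonpos hzero i * quotE K A i =
      ρ.quotH (ρ.coroot i) :=
  commutator_mkQ (quotE_mkQ i) (ρ.quotF_mkQ hdiag hnonpos hzero i) (ρ.quotH_mkQ _)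
    (ρ.wordE_lie_wordF i)

lemma quotE_commutator_quotF_of_ne {i j : V} (hij : i ≠ j) :
    quotE K A i * ρ.quotF hdiag hnonpos hzero j - ρ.quotF hdiag hnonpos hzero j * quotE K A i = 0 :=
  commutator_mkQ (quotE_mkQ i) (ρ.quotF_mkQ hdiag hnonpos hzero j) (fun m => by simp)
    (ρ.wordE_lie_wordF_of_ne hij)

lemma quotH_commutator_quotE (x : 𝔥) (i : V) :
    ρ.quotH x * quotE K A i - quotE K A i * ρ.quotH x = ρ.root i x • quotE K A i :=
  commutator_mkQ (ρ.quotH_mkQ x) (quotE_mkQ i)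
    (fun m => by rw [LinearMap.smul_apply, quotE_mkQ, LinearMap.smul_apply, map_smul])
    (ρ.wordH_lie_wordE x i)

lemma quotH_commutator_quotF (x : 𝔥) (i : V) :
    ρ.quotH x * ρ.quotF hdiag hnonpos hzero i - ρ.quotF hdiag hnonpos hzero i * ρ.quotH x =
      (-ρ.root i x) • ρ.quotF hdiag hnonpos hzero i :=
  commutator_mkQ (ρ.quotH_mkQ x) (ρ.quotF_mkQ hdiag hnonpos hzero i)
    (fun m => by rw [LinearMap.smul_apply, quotF_mkQ, LinearMap.smul_apply, map_smul])
    (ρ.wordH_lie_wordF x i)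

lemma quotE_serre {i j : V} (hij : i ≠ j) :
    ((LieAlgebra.ad K (Module.End K (SerreQuotient K A)) (quotE K A i)) ^ (1 - A i j).toNat)
      (quotE K A j) = 0 := by
  refine end_quotient_ext fun m => ?_
  rw [ad_pow_intertwine (quotE_mkQ i) (quotE_mkQ j), LinearMap.zero_apply, Submodule.mkQ_apply,
    Submodule.Quotient.mk_eq_zero]
  exact wordSerre_mem_serreSubmodule hij m

lemma quotF_serre {i j : V} (hij : i ≠ j) :
    ((LieAlgebra.ad K (Module.End K (SerreQuotient K A)) (ρ.quotF hdiag hnonpos hzero i)) ^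
      (1 - A i j).toNat) (ρ.quotF hdiag hnonpos hzero j) = 0 := by
  refine end_quotient_ext fun m => ?_
  rw [ad_pow_intertwine (ρ.quotF_mkQ hdiag hnonpos hzero i) (ρ.quotF_mkQ hdiag hnonpos hzero j),
    ρ.wordF_serre hdiag hnonpos hzero hij, LinearMap.zero_apply, map_zero, LinearMap.zero_apply]

include hdiag hnonpos hzero in
/-- The Kac–Moody algebra acts on the quotient module with `e i` acting by `quotE`. -/
lemma exists_rep_pos : ∃ θ : ρ.KacMoody →ₗ⁅K⁆ Module.End K (SerreQuotient K A),
    ∀ i, θ (ρ.gen (.e i)) = quotE K A i := by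
  obtain ⟨θ, h, -⟩ := ρ.exists_lieHom ρ.quotH (quotE K A) (ρ.quotF hdiag hnonpos hzero)
    ρ.quotH_commutator_quotH (ρ.quotE_commutator_quotF hdiag hnonpos hzero)
    (fun _ _ => ρ.quotE_commutator_quotF_of_ne hdiag hnonpos hzero) ρ.quotH_commutator_quotE
    (ρ.quotH_commutator_quotF hdiag hnonpos hzero) (fun _ _ => quotE_serre)
    (fun _ _ => ρ.quotF_serre hdiag hnonpos hzero)
  exact ⟨θ, h⟩

include hdiag hnonpos hzero in
/-- The Kac–Moody algebra acts on the quotient module with `f i` acting by `quotE`. -/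
lemma exists_rep_neg : ∃ θ : ρ.KacMoody →ₗ⁅K⁆ Module.End K (SerreQuotient K A),
    ∀ i, θ (ρ.gen (.f i)) = quotE K A i := by
  have hsymm : ∀ {x y z : Module.End K (SerreQuotient K A)}, x * y - y * x = z →
      y * x - x * y = -z := by
    intro x y z h
    refine LinearMap.ext fun m => ?_
    rw [← h]
    simp only [LinearMap.sub_apply, neg_sub]
  have hneg : ∀ {x y z : Module.End K (SerreQuotient K A)}, x * y - y * x = z →
      (-x) * y - y * (-x) = -z := by
    intro x y z h
    refine LinearMap.ext fun m => ?_
    rw [← h]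
    simp only [LinearMap.sub_apply, LinearMap.neg_apply, Module.End.mul_apply, map_neg]
    abel
  -- The same module, twisted by the Chevalley involution: `e` and `f` are exchanged and `𝔥` acts
  -- with the opposite sign.
  obtain ⟨θ, -, h⟩ := ρ.exists_lieHom (-ρ.quotH) (ρ.quotF hdiag hnonpos hzero) (quotE K A)
    (fun x y => by
      refine LinearMap.ext fun m => ?_
      have h := LinearMap.congr_fun (ρ.quotH_commutator_quotH x y) m
      simp only [LinearMap.sub_apply, Module.End.mul_apply, LinearMap.zero_apply] at h
      change -(ρ.quotH x (-(ρ.quotH y m))) - -(ρ.quotH y (-(ρ.quotH x m))) = 0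
      rw [map_neg, map_neg, neg_neg, neg_neg, h])
    (fun i => hsymm (ρ.quotE_commutator_quotF hdiag hnonpos hzero i))
    (fun i j hij => (hsymm (ρ.quotE_commutator_quotF_of_ne hdiag hnonpos hzero
      (Ne.symm hij))).trans (by ext; simp))
    (fun x i => (hneg (ρ.quotH_commutator_quotF hdiag hnonpos hzero x i)).trans
      (by refine LinearMap.ext fun m => ?_; simp))
    (fun x i => (hneg (ρ.quotH_commutator_quotE x i)).trans
      (by refine LinearMap.ext fun m => ?_; simp))
    (fun _ _ => ρ.quotF_serre hdiag hnonpos hzero) (fun _ _ => quotE_serre)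
  exact ⟨θ, h⟩

variable {B : Type*} [Ring B] [Algebra K B] (X : V → B)
  (hX : ∀ i j, i ≠ j → ((LieAlgebra.ad K B (X i)) ^ (1 - A i j).toNat) (X j) = 0)

variable (K) in
/-- The linear map from the free module on words to an algebra that sends words to products. -/
noncomputable def wordEval : (List V →₀ K) →ₗ[K] B :=
  Finsupp.linearCombination K fun w => (w.map X).prod

lemma wordEval_wordE (i : V) (m : List V →₀ K) :
    wordEval K X (wordE K i m) = X i * wordEval K X m := by
  have h : (wordEval K X) ∘ₗ wordE K i = LinearMap.mulLeft K (X i) ∘ₗ wordEval K X :=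
    end_word_ext fun w => by simp [wordEval]
  exact LinearMap.congr_fun h m

include hX in
-- Evaluation turns `wordE i` into left multiplication by `X i`, hence a Serre element of the
-- `wordE` into left multiplication by the corresponding Serre element of the `X`, which is zero.
lemma serreSubmodule_le_ker_wordEval : serreSubmodule K A ≤ LinearMap.ker (wordEval K X) := by
  refine Submodule.span_le.2 ?_
  rintro _ ⟨w, i, j, m, hij, rfl⟩
  change wordEval K X _ = 0
  induction w with
  | nil =>
    have h : ∀ n, wordEval K X (((LieAlgebra.ad K (Module.End K (List V →₀ K)) (wordE K i)) ^ n)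
        (wordE K j) m) = ((LieAlgebra.ad K B (X i)) ^ n) (X j) * wordEval K X m := by
      intro n
      induction n generalizing m with
      | zero => exact wordEval_wordE X j m
      | succ n ih =>
        simp only [pow_succ', Module.End.mul_apply, LieAlgebra.ad_apply,
          LieRing.of_associative_ring_bracket, LinearMap.sub_apply, map_sub, wordEval_wordE, ih,
          sub_mul, mul_assoc]
    rw [List.map_nil, List.prod_nil, Module.End.one_apply, wordSerre, h, hX i j hij, zero_mul]
  | cons k w ih =>
    rw [List.map_cons, List.prod_cons, Module.End.mul_apply, wordEval_wordE, ih, mul_zero]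

include hX in
/-- A representation of a Lie algebra on the quotient module such that elements `γ i` act
by `quotE`, yields a homomorphism from the Lie subalgebra generated by these elements to any
algebra with elements that satisfy the Serre relations. -/
lemma exists_lieHom_lieSpan {L : Type*} [LieRing L] [LieAlgebra K L] (γ : V → L)
    (θ : L →ₗ⁅K⁆ Module.End K (SerreQuotient K A)) (hθ : ∀ i, θ (γ i) = quotE K A i) :
    ∃ η : LieSubalgebra.lieSpan K L (Set.range γ) →ₗ⁅K⁆ B,
      ∀ i, η ⟨γ i, LieSubalgebra.subset_lieSpan ⟨i, rfl⟩⟩ = X i := by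
  let π : SerreQuotient K A →ₗ[K] B :=
    (serreSubmodule K A).liftQ (wordEval K X) (serreSubmodule_le_ker_wordEval X hX)
  have hπ : ∀ m, π ((serreSubmodule K A).mkQ m) = wordEval K X m := fun m => rfl
  let v : SerreQuotient K A := (serreSubmodule K A).mkQ (Finsupp.single [] 1)
  have hv : π v = 1 := by rw [hπ]; simp [wordEval]
  have hgen : ∀ i m, π (θ (γ i) m) = X i * π m := by
    intro i m
    obtain ⟨m, rfl⟩ := (serreSubmodule K A).mkQ_surjective m
    rw [hθ, quotE_mkQ, hπ, hπ, wordEval_wordE]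
  -- Through `π`, every element of the subalgebra acts by left multiplication by its value on the
  -- vacuum. Commutators of operators therefore become commutators in `B`.
  have hmul : ∀ y ∈ LieSubalgebra.lieSpan K L (Set.range γ), ∀ m, π (θ y m) = π (θ y v) * π m := by
    intro y hy
    induction hy using LieSubalgebra.lieSpan_induction with
    | mem y h =>
      obtain ⟨i, rfl⟩ := h
      intro m
      rw [hgen, hgen, hv, mul_one]
    | zero => intro m; simp
    | add y z _ _ hy hz =>
      intro m
      simp only [map_add, LinearMap.add_apply, map_add, add_mul, hy m, hz m]
    | smul c y _ hy =>
      intro m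
      simp only [map_smul, LinearMap.smul_apply, map_smul, smul_mul_assoc, hy m]
    | lie y z _ _ hy hz =>
      intro m
      simp only [LieHom.map_lie, LieRing.of_associative_ring_bracket, LinearMap.sub_apply,
        Module.End.mul_apply, map_sub]
      rw [hy (θ z m), hz (θ y m), hz m, hy m, hy (θ z v), hz (θ y v)]
      simp only [sub_mul, mul_assoc]
  refine ⟨{ toFun := fun y => π (θ y v), map_add' := ?_, map_smul' := ?_, map_lie' := ?_ }, ?_⟩
  · intro y z
    simp
  · intro c y
    simp
  · intro y z
    have h1 := hmul y y.2 (θ z v)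
    have h2 := hmul z z.2 (θ y v)
    simp only [LieSubalgebra.coe_bracket, LieHom.map_lie, LieRing.of_associative_ring_bracket,
      LinearMap.sub_apply, Module.End.mul_apply, map_sub, h1, h2]
  · intro i
    change π (θ (γ i) v) = X i
    rw [hgen, hv, mul_one]

end QuotientVerma

end Realization

/-! ### Words and weight spaces in the enveloping algebra -/

section EnvelopingWords

/-- The degree of a word in the free abelian group. -/
noncomputable def wordDegree {V : Type*} (w : List V) : V →₀ ℤ :=
  (w.map fun i => Finsupp.single i (1 : ℤ)).sum

lemma wordDegree_cons {V : Type*} (i : V) (w : List V) :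
    wordDegree (i :: w) = Finsupp.single i 1 + wordDegree w := rfl

lemma wordDegree_apply {V : Type*} [DecidableEq V] (w : List V) (i : V) :
    wordDegree w i = w.count i := by
  induction w with
  | nil => simp [wordDegree]
  | cons j w ih =>
    rw [wordDegree_cons, Finsupp.add_apply, ih, List.count_cons, Finsupp.single_apply]
    by_cases h : j = i <;> simp [h, add_comm]

lemma eq_replicate_of_wordDegree {V : Type*} {i j : V} (hij : i ≠ j) {k : ℕ} {w : List V}
    (h : wordDegree w = Finsupp.single i (k : ℤ) + Finsupp.single j 1) :
    ∃ m ≤ k, w = List.replicate m i ++ j :: List.replicate (k - m) i := by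
  classical
  have hcount : ∀ v, (w.count v : ℤ) =
      (if i = v then (k : ℤ) else 0) + if j = v then 1 else 0 := by
    intro v
    rw [← wordDegree_apply, h, Finsupp.add_apply, Finsupp.single_apply, Finsupp.single_apply]
  have hmem : ∀ v ∈ w, v ≠ j → v = i := by
    intro v hv hvj
    by_contra hvi
    have h1 := hcount v
    rw [if_neg (Ne.symm hvi), if_neg (Ne.symm hvj)] at h1
    have := List.count_pos_iff.2 hv
    omega
  have hj : w.count j = 1 := by
    have h1 := hcount j
    rw [if_neg hij, if_pos rfl] at h1
    omega
  have hi : w.count i = k := by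
    have h1 := hcount i
    rw [if_pos rfl, if_neg (Ne.symm hij)] at h1
    omega
  obtain ⟨a, b, rfl⟩ := List.append_of_mem (List.count_pos_iff.1 (by omega : 0 < w.count j))
  rw [List.count_append, List.count_cons_self] at hj
  have ha0 : j ∉ a := List.count_eq_zero.1 (by omega)
  have hb0 : j ∉ b := List.count_eq_zero.1 (by omega)
  have ha : a = List.replicate a.length i := List.eq_replicate_of_mem fun v hv =>
    hmem v (by simp [hv]) (by rintro rfl; exact ha0 hv)
  have hb : b = List.replicate b.length i := List.eq_replicate_of_mem fun v hv =>
    hmem v (by simp [hv]) (by rintro rfl; exact hb0 hv)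
  rw [ha, hb, List.count_append, List.count_cons_of_ne (Ne.symm hij), List.count_replicate_self,
    List.count_replicate_self] at hi
  refine ⟨a.length, by omega, ?_⟩
  rw [← ha, ← hi, Nat.add_sub_cancel_left, ← hb]

variable {K : Type*} [Field K] {V : Type*} {L : Type*} [LieRing L] [LieAlgebra K L] (γ : V → L)

/-- The enveloping algebra of the Lie subalgebra generated by a family of elements. -/
abbrev EnvelopingSpan (K : Type*) [Field K] {V : Type*} {L : Type*} [LieRing L] [LieAlgebra K L]
    (γ : V → L) :=
  UniversalEnvelopingAlgebra K (LieSubalgebra.lieSpan K L (Set.range γ))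

variable (K) in
/-- The generators of the enveloping algebra of the Lie subalgebra generated by a family. -/
noncomputable def envelopingGen (i : V) : EnvelopingSpan K γ :=
  UniversalEnvelopingAlgebra.ι K ⟨γ i, LieSubalgebra.subset_lieSpan ⟨i, rfl⟩⟩

/-- The span of the words is a subalgebra containing the image of the Lie algebra, so the universal
property gives a map into it that composes with the inclusion to the identity. -/
lemma span_enveloping_words :
    Submodule.span K (Set.range fun w : List V => (w.map (envelopingGen K γ)).prod) = ⊤ := by
  let W := Submodule.span K (Set.range fun w : List V => (w.map (envelopingGen K γ)).prod)
  have hone : (1 : EnvelopingSpan K γ) ∈ W := Submodule.subset_span ⟨[], rfl⟩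
  have hmul : ∀ x y, x ∈ W → y ∈ W → x * y ∈ W := by
    intro x y hx hy
    have h := Submodule.mul_mem_mul hx hy
    rw [Submodule.span_mul_span] at h
    refine Submodule.span_mono ?_ h
    rintro _ ⟨_, ⟨w, rfl⟩, _, ⟨z, rfl⟩, rfl⟩
    exact ⟨w ++ z, by simp⟩
  let S : Subalgebra K (EnvelopingSpan K γ) := W.toSubalgebra hone hmul
  have hι : ∀ x, UniversalEnvelopingAlgebra.ι K x ∈ S := by
    rintro ⟨x, hx⟩
    induction hx using LieSubalgebra.lieSpan_induction with
    | mem y h =>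
      obtain ⟨i, rfl⟩ := h
      exact Submodule.subset_span ⟨[i], by simp [envelopingGen]⟩
    | zero => exact (congrArg (· ∈ S) (map_zero (UniversalEnvelopingAlgebra.ι K))).mpr S.zero_mem
    | add y z hy' hz' hy hz =>
      exact (congrArg (· ∈ S) (map_add (UniversalEnvelopingAlgebra.ι K)
        (⟨y, hy'⟩ : LieSubalgebra.lieSpan K L (Set.range γ)) ⟨z, hz'⟩)).mpr (S.add_mem hy hz)
    | smul c y hy' hy =>
      exact (congrArg (· ∈ S) (map_smul (UniversalEnvelopingAlgebra.ι K) c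
        (⟨y, hy'⟩ : LieSubalgebra.lieSpan K L (Set.range γ)))).mpr (S.smul_mem hy c)
    | lie y z hy' hz' hy hz =>
      exact (congrArg (· ∈ S) (LieHom.map_lie (UniversalEnvelopingAlgebra.ι K)
        (⟨y, hy'⟩ : LieSubalgebra.lieSpan K L (Set.range γ)) ⟨z, hz'⟩)).mpr
        (S.sub_mem (S.mul_mem hy hz) (S.mul_mem hz hy))
  let φ : LieSubalgebra.lieSpan K L (Set.range γ) →ₗ⁅K⁆ S :=
    { toFun := fun x => ⟨UniversalEnvelopingAlgebra.ι K x, hι x⟩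
      map_add' := fun x y => Subtype.ext (map_add _ x y)
      map_smul' := fun c x => Subtype.ext (map_smul _ c x)
      map_lie' := fun {x y} => Subtype.ext (LieHom.map_lie (UniversalEnvelopingAlgebra.ι K) x y) }
  have hid : S.val.comp (UniversalEnvelopingAlgebra.lift K φ) = AlgHom.id K _ := by
    apply UniversalEnvelopingAlgebra.hom_ext
    refine LieHom.ext fun x => ?_
    change S.val (UniversalEnvelopingAlgebra.lift K φ (UniversalEnvelopingAlgebra.ι K x)) = _
    rw [UniversalEnvelopingAlgebra.lift_ι_apply]
    rfl
  refine eq_top_iff.2 fun x _ => ?_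
  have h := DFunLike.congr_fun hid x
  have h2 : S.val (UniversalEnvelopingAlgebra.lift K φ x) ∈ S := Subtype.property _
  exact (congrArg (· ∈ S) h).mp h2

variable {γ} {𝔥 : Type*} [AddCommGroup 𝔥] [Module K 𝔥]
  {δ : 𝔥 → LieDerivation K (LieSubalgebra.lieSpan K L (Set.range γ))
    (LieSubalgebra.lieSpan K L (Set.range γ))}
  {ω : V → Module.Dual K 𝔥}

/-- The linear combination of weights that corresponds to a degree. -/
noncomputable def degreeWeight (ω : V → Module.Dual K 𝔥) (d : V →₀ ℤ) : Module.Dual K 𝔥 :=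
  d.sum fun i n => n • ω i

lemma degreeWeight_add (c d : V →₀ ℤ) :
    degreeWeight ω (c + d) = degreeWeight ω c + degreeWeight ω d :=
  Finsupp.sum_add_index' (fun _ => zero_smul _ _) (fun _ _ _ => add_smul _ _ _)

lemma degreeWeight_single (i : V) (n : ℤ) : degreeWeight ω (Finsupp.single i n) = n • ω i :=
  Finsupp.sum_single_index (zero_smul _ _)

/-- Integer coefficients stay distinct in `K` because the characteristic is zero. -/
lemma degreeWeight_injective [CharZero K] (hω : LinearIndependent K ω) :
    Function.Injective (degreeWeight ω) := by
  have hmap : ∀ d : V →₀ ℤ, degreeWeight ω d = Finsupp.linearCombination K ω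
      (d.mapRange (Int.cast : ℤ → K) Int.cast_zero) := by
    intro d
    rw [Finsupp.linearCombination_apply,
      Finsupp.sum_mapRange_index (h := fun i a => a • ω i) (fun _ => zero_smul _ _)]
    simp only [degreeWeight, Int.cast_smul_eq_zsmul]
  intro c d h
  rw [hmap, hmap] at h
  exact Finsupp.mapRange_injective _ Int.cast_zero Int.cast_injective (hω h)

lemma envelopingDeriv_word (hδ : ∀ x i, δ x ⟨γ i, LieSubalgebra.subset_lieSpan ⟨i, rfl⟩⟩ =
      ω i x • ⟨γ i, LieSubalgebra.subset_lieSpan ⟨i, rfl⟩⟩) (x : 𝔥) (w : List V) :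
    envelopingDeriv (δ x) (w.map (envelopingGen K γ)).prod =
      degreeWeight ω (wordDegree w) x • (w.map (envelopingGen K γ)).prod := by
  induction w with
  | nil =>
    have h := envelopingDeriv_mul (δ x) 1 1
    simp only [mul_one, one_mul, left_eq_add] at h
    simp [h, wordDegree, degreeWeight]
  | cons i w ih =>
    rw [List.map_cons, List.prod_cons, envelopingDeriv_mul, ih, wordDegree_cons, degreeWeight_add,
      degreeWeight_single, envelopingGen, envelopingDeriv_ι, hδ, map_smul, one_smul,
      LinearMap.add_apply, add_smul, mul_smul_comm, smul_mul_assoc, add_comm]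

/-- A weight vector of the enveloping algebra is a combination of words of the same weight. -/
lemma mem_span_words_of_weight [CharZero K] (hω : LinearIndependent K ω)
    (hδ : ∀ x i, δ x ⟨γ i, LieSubalgebra.subset_lieSpan ⟨i, rfl⟩⟩ =
      ω i x • ⟨γ i, LieSubalgebra.subset_lieSpan ⟨i, rfl⟩⟩) {d : V →₀ ℤ} {u : EnvelopingSpan K γ}
    (hu : ∀ x, envelopingDeriv (δ x) u = degreeWeight ω d x • u) :
    u ∈ Submodule.span K {y | ∃ w : List V, wordDegree w = d ∧
      y = (w.map (envelopingGen K γ)).prod} := by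
  let f : 𝔥 → Module.End K (EnvelopingSpan K γ) := fun x => envelopingDeriv (δ x)
  let W : (V →₀ ℤ) → Submodule K (EnvelopingSpan K γ) := fun c =>
    Submodule.span K {y | ∃ w : List V, wordDegree w = c ∧ y = (w.map (envelopingGen K γ)).prod}
  let χ : (V →₀ ℤ) → 𝔥 → K := fun c x => degreeWeight ω c x
  let U : (V →₀ ℤ) → Submodule K (EnvelopingSpan K γ) := fun c =>
    ⨅ x, (f x).maxGenEigenspace (χ c x)
  have hχ : Function.Injective χ := fun c d h =>
    degreeWeight_injective hω (LinearMap.ext fun x => congrFun h x)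
  have heigen : ∀ {c v}, (∀ x, f x v = χ c x • v) → v ∈ U c := by
    intro c v h
    refine (Submodule.mem_iInf _).2 fun x => ?_
    exact Module.End.mem_maxGenEigenspace _ _ _ |>.2 ⟨1, by simp [h x]⟩
  have hcomm : ∀ x y, Commute (f x) (f y) := by
    intro x y
    refine LinearMap.ext_on (span_enveloping_words (K := K) γ) ?_
    rintro _ ⟨w, rfl⟩
    simp only [f, Module.End.mul_apply, envelopingDeriv_word hδ, map_smul, smul_smul, mul_comm]
  -- Joint generalized eigenspaces of commuting operators are independent for distinct characters.
  -- Genuine weight vectors lie in them with exponent one.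
  have hind : iSupIndep U :=
    (Module.End.independent_iInf_maxGenEigenspace_of_forall_mapsTo f fun x y φ =>
      Module.End.mapsTo_maxGenEigenspace_of_comm (hcomm y x) φ).comp hχ
  have hWU : ∀ c, W c ≤ U c := by
    intro c
    refine Submodule.span_le.2 ?_
    rintro _ ⟨w, rfl, rfl⟩
    exact heigen fun x => envelopingDeriv_word hδ x w
  have htop : u ∈ W d ⊔ ⨆ c, ⨆ _ : c ≠ d, W c := by
    have h : u ∈ Submodule.span K (Set.range fun w : List V => (w.map (envelopingGen K γ)).prod) :=
      by rw [span_enveloping_words]; trivial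
    refine Submodule.span_le.2 ?_ h
    rintro _ ⟨w, rfl⟩
    have hw : (w.map (envelopingGen K γ)).prod ∈ W (wordDegree w) :=
      Submodule.subset_span ⟨w, rfl, rfl⟩
    by_cases hwd : wordDegree w = d
    · exact Submodule.mem_sup_left (hwd ▸ hw)
    · exact Submodule.mem_sup_right (Submodule.mem_iSup_of_mem _ (Submodule.mem_iSup_of_mem hwd hw))
  obtain ⟨a, ha, b, hb, rfl⟩ := Submodule.mem_sup.1 htop
  have hbU : b ∈ ⨆ c, ⨆ _ : c ≠ d, U c := iSup₂_mono (fun c _ => hWU c) hb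
  -- The remainder `b = u - a` has weight `d` and is also a sum of components of other degrees, so
  -- independence forces it to vanish.
  have hbd : b ∈ U d := by
    have h := sub_mem (heigen hu) (hWU d ha)
    rwa [add_sub_cancel_left] at h
  have hb0 : b = 0 := Submodule.disjoint_def.1 (hind d) b hbd hbU
  rw [hb0, add_zero]
  exact ha

section Homomorphism

variable {B : Type*} [Ring B] [Algebra K B] (ψ : EnvelopingSpan K γ →ₐ[K] B)

lemma map_word (w : List V) : ψ (w.map (envelopingGen K γ)).prod =
    (w.map fun i => ψ (envelopingGen K γ i)).prod := by
  rw [map_list_prod, List.map_map]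
  rfl

lemma map_weight_mem [CharZero K] (hω : LinearIndependent K ω)
    (hδ : ∀ x i, δ x ⟨γ i, LieSubalgebra.subset_lieSpan ⟨i, rfl⟩⟩ =
      ω i x • ⟨γ i, LieSubalgebra.subset_lieSpan ⟨i, rfl⟩⟩) {d : V →₀ ℤ} {u : EnvelopingSpan K γ}
    (hu : ∀ x, envelopingDeriv (δ x) u = degreeWeight ω d x • u) (S : Submodule K B)
    (hS : ∀ w : List V, wordDegree w = d → (w.map fun i => ψ (envelopingGen K γ i)).prod ∈ S) :
    ψ u ∈ S := by
  have h : Submodule.span K {y | ∃ w : List V, wordDegree w = d ∧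
      y = (w.map (envelopingGen K γ)).prod} ≤ S.comap ψ.toLinearMap := by
    refine Submodule.span_le.2 ?_
    rintro _ ⟨w, hw, rfl⟩
    change ψ _ ∈ S
    rw [map_word]
    exact hS w hw
  exact h (mem_span_words_of_weight hω hδ hu)

/-- No independence of the words in the enveloping algebra is needed: they span the weight space,
and independence of their images forces all coefficients to vanish. -/
lemma eq_zero_of_map_eq_zero [CharZero K] (hω : LinearIndependent K ω)
    (hδ : ∀ x i, δ x ⟨γ i, LieSubalgebra.subset_lieSpan ⟨i, rfl⟩⟩ =
      ω i x • ⟨γ i, LieSubalgebra.subset_lieSpan ⟨i, rfl⟩⟩) {i j : V} (hij : i ≠ j) {k : ℕ}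
    {u : EnvelopingSpan K γ}
    (hu : ∀ x, envelopingDeriv (δ x) u =
      degreeWeight ω (Finsupp.single i (k : ℤ) + Finsupp.single j 1) x • u)
    (hind : ∀ c : ℕ → K, ∑ m ∈ Finset.range (k + 1), c m • (ψ (envelopingGen K γ i) ^ m *
      ψ (envelopingGen K γ j) * ψ (envelopingGen K γ i) ^ (k - m)) = 0 → ∀ m ≤ k, c m = 0)
    (h0 : ψ u = 0) : u = 0 := by
  let e := envelopingGen K γ
  have hspan : Submodule.span K {y | ∃ w : List V,
      wordDegree w = Finsupp.single i (k : ℤ) + Finsupp.single j 1 ∧ y = (w.map e).prod} ≤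
      Submodule.span K ((fun m => e i ^ m * e j * e i ^ (k - m)) '' (Finset.range (k + 1) : Set ℕ)) := by
    refine Submodule.span_mono ?_
    rintro _ ⟨w, hw, rfl⟩
    obtain ⟨m, hm, rfl⟩ := eq_replicate_of_wordDegree hij hw
    exact ⟨m, by simpa [Nat.lt_succ_iff] using hm, by simp [mul_assoc]⟩
  obtain ⟨c, hc⟩ := (Submodule.mem_span_image_finset_iff_exists_fun K).1
    (hspan (mem_span_words_of_weight hω hδ hu))
  let c' : ℕ → K := fun m => if h : m ∈ Finset.range (k + 1) then c ⟨m, h⟩ else 0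
  have hc' : ∑ m ∈ Finset.range (k + 1), c' m • (e i ^ m * e j * e i ^ (k - m)) = u := by
    rw [← hc, ← Finset.sum_coe_sort]
    refine Finset.sum_congr rfl fun m _ => ?_
    simp only [c', dif_pos m.2]
  have hz := hind c' (by
    rw [← h0, ← hc', map_sum]
    simp only [map_smul, map_mul, map_pow, e])
  rw [← hc']
  refine Finset.sum_eq_zero fun m hm => ?_
  rw [hz m (Nat.lt_succ_iff.1 (Finset.mem_range.1 hm)), zero_smul]

end Homomorphism

end EnvelopingWords

/-! ### Weight spaces of both halves and conclusion -/

namespace Realization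

variable {K : Type*} [Field K] {V : Type*} {A : V → V → ℤ} {𝔥 : Type*} [AddCommGroup 𝔥]
  [Module K 𝔥] (ρ : Realization K A 𝔥)

lemma adPos_gen (x : 𝔥) (i : V) :
    ρ.adPos x ⟨ρ.gen (.e i), LieSubalgebra.subset_lieSpan ⟨i, rfl⟩⟩ =
      ρ.root i x • ⟨ρ.gen (.e i), LieSubalgebra.subset_lieSpan ⟨i, rfl⟩⟩ :=
  Subtype.ext (ρ.h_lie_e x i)

lemma adNeg_gen (x : 𝔥) (i : V) :
    ρ.adNeg x ⟨ρ.gen (.f i), LieSubalgebra.subset_lieSpan ⟨i, rfl⟩⟩ =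
      (-ρ.root) i x • ⟨ρ.gen (.f i), LieSubalgebra.subset_lieSpan ⟨i, rfl⟩⟩ :=
  Subtype.ext (ρ.h_lie_f x i)

lemma envelopingDeriv_of_mem_posWeightSpace {d : V →₀ ℤ} {u : ρ.UPos}
    (hu : u ∈ ρ.posWeightSpace d) (x : 𝔥) :
    envelopingDeriv (ρ.adPos x) u = degreeWeight ρ.root d x • u := by
  have h := (Submodule.mem_iInf _).1 hu x
  rw [LinearMap.mem_ker, LinearMap.sub_apply, sub_eq_zero] at h
  exact h

lemma weight_eq_degreeWeight_neg (d : V →₀ ℤ) :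
    ρ.weight d = degreeWeight (-ρ.root) (-d) := by
  rw [degreeWeight, Finsupp.sum_neg_index (h := fun i n => n • (-ρ.root) i)
    (fun _ => zero_smul _ _)]
  simp only [Pi.neg_apply, neg_smul_neg]
  rfl

lemma envelopingDeriv_of_mem_negWeightSpace {d : V →₀ ℤ} {u : ρ.UNeg}
    (hu : u ∈ ρ.negWeightSpace d) (x : 𝔥) :
    envelopingDeriv (ρ.adNeg x) u = degreeWeight (-ρ.root) (-d) x • u := by
  have h := (Submodule.mem_iInf _).1 hu x
  rw [LinearMap.mem_ker, LinearMap.sub_apply, sub_eq_zero, weight_eq_degreeWeight_neg] at h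
  exact h

end Realization

namespace Multiquiver

variable {V E : Type*} (Γ : Multiquiver V E) (K : Type*) [Field K]

lemma X_word_mem_algDeg (w : List V) : (w.map (Γ.X K)).prod ∈ Γ.algDeg K (wordDegree w) := by
  refine ⟨(Γ.datum K).word (fun _ _ => 1) (w.map .X), ?_, ?_⟩
  · have h := (Γ.datum K).word_mem_cdeg (fun _ _ => 1) (w.map .X)
    rw [List.map_map] at h
    exact h
  · change (Γ.datum K).proj (fun _ _ => 1) (((w.map TGWDatum.Gen.X).map _).prod) = _
    rw [map_list_prod, List.map_map, List.map_map]
    rfl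

lemma Y_word_mem_algDeg (w : List V) : (w.map (Γ.Y K)).prod ∈ Γ.algDeg K (-wordDegree w) := by
  refine ⟨(Γ.datum K).word (fun _ _ => 1) (w.map .Y), ?_, ?_⟩
  · have h := (Γ.datum K).word_mem_cdeg (fun _ _ => 1) (w.map .Y)
    have hdeg : ((w.map (TGWDatum.Gen.Y (R := MvPolynomial E K))).map TGWDatum.Gen.deg).sum =
        -wordDegree w := by
      induction w with
      | nil => rfl
      | cons i w ih =>
        rw [List.map_cons, List.map_cons, List.sum_cons,
          ih ((Γ.datum K).word_mem_cdeg (fun _ _ => 1) (w.map .Y)), wordDegree_cons, neg_add,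
          ← Finsupp.single_neg]
        rfl
    rw [hdeg] at h
    exact h
  · change (Γ.datum K).proj (fun _ _ => 1) (((w.map TGWDatum.Gen.Y).map _).prod) = _
    rw [map_list_prod, List.map_map, List.map_map]
    rfl

end Multiquiver

lemma LinearIndependent.neg_family {K V M : Type*} [Field K] [AddCommGroup M] [Module K M]
    {v : V → M} (h : LinearIndependent K v) : LinearIndependent K (-v) :=
  h.map' (LinearEquiv.neg K (M := M)).toLinearMap (LinearEquiv.ker _)

theorem theorem5p4 {K : Type*} [Field K] [CharZero K] {V E : Type*} (Γ : Multiquiver V E)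
    {𝔥 : Type*} [AddCommGroup 𝔥] [Module K 𝔥] (ρ : Realization K Γ.cartan 𝔥) :
    (∃ ψ : ρ.UPos →ₐ[K] Γ.Alg K,
      (∀ i, ψ (ρ.eU i) = Γ.X K i) ∧
      (∀ d : V →₀ ℤ, ∀ x ∈ ρ.posWeightSpace d, ψ x ∈ Γ.algDeg K d) ∧
      ∀ i j : V, i ≠ j → ∀ k : ℕ, (k : ℤ) ≤ -Γ.cartan i j →
        Set.InjOn ψ (ρ.posWeightSpace (Finsupp.single i (k : ℤ) + Finsupp.single j 1))) ∧
    (∃ ψ : ρ.UNeg →ₐ[K] Γ.Alg K,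
      (∀ i, ψ (ρ.fU i) = Γ.Y K i) ∧
      (∀ d : V →₀ ℤ, ∀ x ∈ ρ.negWeightSpace d, ψ x ∈ Γ.algDeg K d) ∧
      ∀ i j : V, i ≠ j → ∀ k : ℕ, (k : ℤ) ≤ -Γ.cartan i j →
        Set.InjOn ψ (ρ.negWeightSpace (-(Finsupp.single i (k : ℤ)) - Finsupp.single j 1))) := by
  have hdiag : ∀ i, Γ.cartan i i = 2 := fun i => if_pos rfl
  have hnonpos : ∀ i j, i ≠ j → Γ.cartan i j ≤ 0 := fun i j hij => by
    rw [Γ.cartan_eq_neg_mult hij]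
    omega
  have hzero : ∀ i j, Γ.cartan i j = 0 → Γ.cartan j i = 0 :=
    fun i j => Γ.cartan_eq_zero_of_cartan_eq_zero
  constructor
  · obtain ⟨θ, hθ⟩ := ρ.exists_rep_pos hdiag hnonpos hzero
    obtain ⟨η, hη⟩ := Realization.exists_lieHom_lieSpan (Γ.X K) (fun _ _ => Γ.serre_X) _ θ hθ
    have hψ : ∀ i, UniversalEnvelopingAlgebra.lift K η (ρ.eU i) = Γ.X K i := fun i =>
      (UniversalEnvelopingAlgebra.lift_ι_apply K η _).trans (hη i)
    refine ⟨UniversalEnvelopingAlgebra.lift K η, hψ, ?_, ?_⟩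
    · intro d u hu
      refine map_weight_mem (ψ := UniversalEnvelopingAlgebra.lift K η) ρ.root_indep ρ.adPos_gen
        (ρ.envelopingDeriv_of_mem_posWeightSpace hu) _ ?_
      rintro w rfl
      exact (congrArg (fun g => (w.map g).prod ∈ Γ.algDeg K (wordDegree w)) (funext hψ)).mpr
        (Γ.X_word_mem_algDeg K w)
    · intro i j hij k hk u hu v hv huv
      refine sub_eq_zero.1 (eq_zero_of_map_eq_zero (UniversalEnvelopingAlgebra.lift K η)
        ρ.root_indep ρ.adPos_gen hij
        (ρ.envelopingDeriv_of_mem_posWeightSpace (sub_mem hu hv)) (fun c hc => ?_)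
        ((map_sub _ u v).trans (sub_eq_zero.2 huv)))
      refine Γ.X_words_indep hij hk c (Eq.trans ?_ hc)
      rw [← hψ i, ← hψ j]
      rfl
  · obtain ⟨θ, hθ⟩ := ρ.exists_rep_neg hdiag hnonpos hzero
    obtain ⟨η, hη⟩ := Realization.exists_lieHom_lieSpan (Γ.Y K) (fun _ _ => Γ.serre_Y) _ θ hθ
    have hψ : ∀ i, UniversalEnvelopingAlgebra.lift K η (ρ.fU i) = Γ.Y K i := fun i =>
      (UniversalEnvelopingAlgebra.lift_ι_apply K η _).trans (hη i)
    refine ⟨UniversalEnvelopingAlgebra.lift K η, hψ, ?_, ?_⟩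
    · intro d u hu
      refine map_weight_mem (ψ := UniversalEnvelopingAlgebra.lift K η) ρ.root_indep.neg_family
        ρ.adNeg_gen (ρ.envelopingDeriv_of_mem_negWeightSpace hu) _ ?_
      intro w hw
      rw [← neg_neg d, ← hw]
      exact (congrArg (fun g => (w.map g).prod ∈ Γ.algDeg K (-wordDegree w)) (funext hψ)).mpr
        (Γ.Y_word_mem_algDeg K w)
    · intro i j hij k hk u hu v hv huv
      have hw := ρ.envelopingDeriv_of_mem_negWeightSpace (sub_mem hu hv)
      -- Relative to the negated roots the weight has the nonnegative degree `k α_i + α_j`, so the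
      -- same word argument applies.
      rw [neg_sub, sub_neg_eq_add, add_comm] at hw
      refine sub_eq_zero.1 (eq_zero_of_map_eq_zero (UniversalEnvelopingAlgebra.lift K η)
        ρ.root_indep.neg_family ρ.adNeg_gen hij hw (fun c hc => ?_)
        ((map_sub _ u v).trans (sub_eq_zero.2 huv)))
      refine Γ.Y_words_indep hij hk c (Eq.trans ?_ hc)
      rw [← hψ i, ← hψ j]
      rfl
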